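/- **Definitions.** A *cone* in $\mathbb{R}^2$ is a set $\mathcal{C}=\mathcal{C}(e,\theta)=\{x\in\mathbb{R}^2: |x\cdot e|\ge\theta|x|\}$ with $|e|=1$ and $0<\theta\le 1$. A *maximal $\mathcal{C}$-graph* is a set $\gamma\subset\mathbb{R}^2$ such that $x-y\in\mathcal{C}$ for all $x,y\in\gamma$ and such that the orthogonal projection of $\gamma$ to $\operatorname{span}(e)$ is surjective. Two cones $\mathcal{C}_1,\mathcal{C}_2$ are *independent* if $$\inf\{\angle(x_1,x_2): x_1\in\mathcal{C}_1\setminus\{0\},\ x_2\in\mathcal{C}_2\setminus\{0\}\}>0.$$ Let $\mu$ be a Radon measure on $\mathbb{R}^2$. An *Alberti representation of $\mu$ by $\mathcal{C}$-graphs* consists of a measure space $(\Omega,\Sigma,\mathbb{P})$ with $\mathbb{P}(\Omega)<\infty$ and a map $\gamma$ from $\Omega$ to the maximal $\mathcal{C}$-graphs such that $\omega\mapsto\mathcal{H}^1(B\cap\gamma(\omega))$ is $\Sigma$-measurable for every Borel set $B\subset\mathbb{R}^2$, and such that $\mu\ll\nu$, where $\nu(B):=\int_\Omega\mathcal{H}^1(B\cap\gamma(\omega))\,d\mathbb{P}(\omega)$.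 It is *bounded above* on a Borel set $B$ if $\frac{d\mu}{d\nu}\in L^\infty(B,\nu)$, and *bounded below* on $B$ if $(\frac{d\mu}{d\nu})^{-1}\in L^\infty(B,\nu)$; if $B=\mathbb{R}^2$, the words "on $B$" are omitted. Two representations, by $\mathcal{C}_1$-graphs and by $\mathcal{C}_2$-graphs, are *independent* if $\mathcal{C}_1$ and $\mathcal{C}_2$ are independent. Write $B(r)=B(0,r)$. For a Borel set $U$, $\mu\in L^p(U)$ means that $\mu|_U$ is absolutely continuous with respect to Lebesgue measure with density in $L^p(U)$; the density is denoted $\mu(x)$. **Theorem.** Let $\mu$ be a Radon measure on $\mathbb{R}^2$ with two independent Alberti representations. 1. If both representations are bounded above, then $\mu\in L^2(\mathbb{R}^2)$. 2. If both representations are bounded above on $B(2)$ and bounded below on $B(2)$, then $\mu|_{B(1)}$ is absolutely continuous with respect to Lebesgue measure, and there is a constant $C\ge 1$ such that $$\left(\frac{1}{r^2}\int_{B(x,r)}\mu(y)^2\,dy\right)^{1/2}\le\frac{C}{r^2}\int_{B(x,r)}\mu(y)\,dy\qquad\text{for all } x\in\mathbb{R}^2,\ r>0 \text{ with } B(x,r)\subset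 B(1).$$ Moreover, $\mu\in L^{2+\epsilon}(B(\tfrac12))$ for some $\epsilon>0$. -/

import Mathlib

open MeasureTheory Set Metric
open scoped ENNReal NNReal

noncomputable section

namespace Alberti

/-- Parameters `(e, θ)` of a cone in `ℝ^d`: a unit vector `e` and `0 < θ ≤ 1`. -/
structure Cone (d : ℕ) where
  e : EuclideanSpace ℝ (Fin d)
  θ : ℝ
  norm_e : ‖e‖ = 1
  θ_pos : 0 < θ
  θ_le_one : θ ≤ 1

/-- The cone `{x : |x ⬝ e| ≥ θ |x|}`. -/
def Cone.carrier {d : ℕ} (C : Cone d) : Set (EuclideanSpace ℝ (Fin d)) :=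
  {x | C.θ * ‖x‖ ≤ |inner ℝ x C.e|}

/-- `γ` is a `C`-graph: all differences of points of `γ` lie in the cone. -/
def Cone.IsGraph {d : ℕ} (C : Cone d) (γ : Set (EuclideanSpace ℝ (Fin d))) : Prop :=
  ∀ x ∈ γ, ∀ y ∈ γ, x - y ∈ C.carrier

/-- `γ` is a maximal `C`-graph: the orthogonal projection of `γ` to `span e` is surjective.
As `e` is a unit vector, that projection is `x ↦ (x ⬝ e) e`. -/
def Cone.IsMaximalGraph {d : ℕ} (C : Cone d) (γ : Set (EuclideanSpace ℝ (Fin d))) : Prop :=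
  C.IsGraph γ ∧ ∀ t : ℝ, ∃ x ∈ γ, inner ℝ x C.e = t

/-- Two cones are independent if the infimum of the angles between their nonzero elements is
positive. -/
def Cone.Independent {d : ℕ} (C₁ C₂ : Cone d) : Prop :=
  ∃ τ : ℝ, 0 < τ ∧ ∀ x₁ ∈ C₁.carrier \ {0}, ∀ x₂ ∈ C₂.carrier \ {0},
    τ ≤ InnerProductGeometry.angle x₁ x₂

/-- The measure `ν(B) = ∫ H¹(B ∩ γ(ω)) dP(ω)`; see `graphMeasure_apply`. -/
def graphMeasure {d : ℕ} {Ω : Type*} [MeasurableSpace Ω] (P : Measure Ω)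
    (γ : Ω → Set (EuclideanSpace ℝ (Fin d))) : Measure (EuclideanSpace ℝ (Fin d)) :=
  P.bind fun ω => (Measure.hausdorffMeasure 1).restrict (γ ω)

theorem graphMeasure_apply {d : ℕ} {Ω : Type*} [MeasurableSpace Ω] (P : Measure Ω)
    (γ : Ω → Set (EuclideanSpace ℝ (Fin d)))
    (hγ : ∀ B : Set (EuclideanSpace ℝ (Fin d)), MeasurableSet B →
      Measurable fun ω => Measure.hausdorffMeasure 1 (B ∩ γ ω))
    {B : Set (EuclideanSpace ℝ (Fin d))} (hB : MeasurableSet B) :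
    graphMeasure P γ B = ∫⁻ ω, Measure.hausdorffMeasure 1 (B ∩ γ ω) ∂P := by
  have hm : Measurable fun ω =>
      (Measure.hausdorffMeasure 1 : Measure (EuclideanSpace ℝ (Fin d))).restrict (γ ω) := by
    refine Measure.measurable_of_measurable_coe _ fun s hs => ?_
    simpa only [Measure.restrict_apply hs] using hγ s hs
  rw [graphMeasure, Measure.bind_apply hB hm.aemeasurable]
  simp only [Measure.restrict_apply hB]

/-- An Alberti representation of `μ` by `C`-graphs, with parameter space `Ω`. The density is not
recorded: it is determined by the remaining data, see `AlbertiRep.density`. -/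
structure AlbertiRep {d : ℕ} (μ : Measure (EuclideanSpace ℝ (Fin d))) (C : Cone d)
    (Ω : Type*) [MeasurableSpace Ω] where
  P : Measure Ω
  finite_P : IsFiniteMeasure P
  γ : Ω → Set (EuclideanSpace ℝ (Fin d))
  maximal : ∀ ω, C.IsMaximalGraph (γ ω)
  measurable_hausdorff : ∀ B : Set (EuclideanSpace ℝ (Fin d)), MeasurableSet B →
    Measurable fun ω => Measure.hausdorffMeasure 1 (B ∩ γ ω)
  absolutelyContinuous : μ ≪ graphMeasure P γ

section

variable {d : ℕ} {μ : Measure (EuclideanSpace ℝ (Fin d))} {C : Cone d}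
  {Ω : Type*} [MeasurableSpace Ω]

/-- The measure `ν` of a representation. -/
def AlbertiRep.ν (R : AlbertiRep μ C Ω) : Measure (EuclideanSpace ℝ (Fin d)) :=
  graphMeasure R.P R.γ

/-- The density `dμ/dν`. -/
def AlbertiRep.density (R : AlbertiRep μ C Ω) : EuclideanSpace ℝ (Fin d) → ℝ≥0∞ :=
  μ.rnDeriv R.ν

/-- The representation is bounded above on `B`: `dμ/dν ∈ L^∞(B, ν)`. -/
def AlbertiRep.BoAOn (R : AlbertiRep μ C Ω) (B : Set (EuclideanSpace ℝ (Fin d))) : Prop :=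
  MemLp R.density ∞ (R.ν.restrict B)

/-- The representation is bounded below on `B`: `(dμ/dν)⁻¹ ∈ L^∞(B, ν)`, where `0⁻¹ = ∞`. -/
def AlbertiRep.BoBOn (R : AlbertiRep μ C Ω) (B : Set (EuclideanSpace ℝ (Fin d))) : Prop :=
  MemLp (fun x => (R.density x)⁻¹) ∞ (R.ν.restrict B)

/-- The representation is bounded above (on the whole space). -/
def AlbertiRep.BoA (R : AlbertiRep μ C Ω) : Prop :=
  MemLp R.density ∞ R.ν

end

/-- `μ ∈ L^p(U)`: on `U`, the measure `μ` is absolutely continuous with respect to Lebesgue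
measure, with density in `L^p(U)`. -/
def MeasureInLp {d : ℕ} (μ : Measure (EuclideanSpace ℝ (Fin d))) (p : ℝ≥0∞)
    (U : Set (EuclideanSpace ℝ (Fin d))) : Prop :=
  μ.restrict U ≪ volume ∧ MemLp (μ.rnDeriv volume) p (volume.restrict U)

end Alberti

end

/-! The heart is transversality. If two graphs belong to independent cones, points y, z on them with
|y - z| ≤ s are confined to a ball of radius comparable to s, and a graph has length at most
comparable to s there. Hence the product of the two length measures gives the s-neighbourhood of the
diagonal mass O(s²), and integrating over both parameter spaces gives the same for ν₁ × ν₂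
(`lintegral_ν_closedBall_le`). An upper bound μ ≤ Mνᵢ yields μ(B)² ≤ M²ν₁(B)ν₂(B) on balls B of
radius δ. Fubini then bounds the averages of μ over such balls in L², uniformly in δ. Letting δ → 0
gives absolute continuity and an L² density. Localised to a set U, only graphs that meet U count:
the squared L² norm is O(p₁p₂), where pᵢ is the P-mass of those graphs
(`exists_lintegral_rnDeriv_sq_le`).

With lower bounds as well, a graph that meets B(x,r) has length at least θr in B(x,2r), so pᵢ =
O(μ(B(x,2r))/r). This is a reverse Hölder inequality with a doubled ball on the right, and doubling
of μ removes the enlargement (`exists_reverse_holder`).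

For doubling, fix a centre x. Every y is seen from x by one of the cones at a definite angle to the
circle around x through y. A graph of that cone through y therefore enters a slightly smaller
concentric ball and has length comparable to r there. So μ(B(x,r)) is controlled by μ(B(x,ρr)) with
a fixed ρ < 1, and iteration gives doubling (`exists_doubling`).

Finally, Gehring's lemma turns the reverse Hölder inequality into integrability above the exponent
2: stopping balls and a Vitali covering give an estimate on level sets, whence geometric decay of
the truncated square integrals. -/

namespace Alberti

/-! ### Planar geometry and transversality of cones -/

/-- The cross product (signed area) of two vectors of the plane. -/
def cross (v w : EuclideanSpace ℝ (Fin 2)) : ℝ := v 0 * w 1 - v 1 * w 0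

theorem inner_eq_two (v w : EuclideanSpace ℝ (Fin 2)) :
    inner ℝ v w = v 0 * w 0 + v 1 * w 1 := by
  rw [PiLp.inner_apply, Fin.sum_univ_two]
  simp [mul_comm]

theorem norm_sq_eq_two (v : EuclideanSpace ℝ (Fin 2)) : ‖v‖ ^ 2 = v 0 ^ 2 + v 1 ^ 2 := by
  rw [← real_inner_self_eq_norm_sq, inner_eq_two]; ring

theorem abs_cross_le (v w : EuclideanSpace ℝ (Fin 2)) : |cross v w| ≤ ‖v‖ * ‖w‖ := by
  apply abs_le_of_sq_le_sq _ (by positivity)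
  rw [mul_pow, norm_sq_eq_two, norm_sq_eq_two, cross]
  nlinarith [sq_nonneg (v 0 * w 0 + v 1 * w 1)]

theorem sin_angle_mul_norm (v w : EuclideanSpace ℝ (Fin 2)) :
    Real.sin (InnerProductGeometry.angle v w) * (‖v‖ * ‖w‖) = |cross v w| := by
  rw [InnerProductGeometry.sin_angle_mul_norm_mul_norm, ← Real.sqrt_sq_eq_abs]
  congr 1
  rw [inner_eq_two, inner_eq_two, inner_eq_two, cross]
  ring

theorem Cone.neg_mem {d : ℕ} {C : Cone d} {v : EuclideanSpace ℝ (Fin d)} (hv : v ∈ C.carrier) :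
    -v ∈ C.carrier := by
  simpa [Cone.carrier] using hv

/-- Independent cones are uniformly transversal. -/
theorem Cone.Independent.exists_cross {C₁ C₂ : Cone 2} (h : C₁.Independent C₂) :
    ∃ κ : ℝ, 0 < κ ∧ κ ≤ 1 ∧ ∀ v ∈ C₁.carrier, ∀ w ∈ C₂.carrier,
      κ * (‖v‖ * ‖w‖) ≤ |cross v w| := by
  obtain ⟨τ, hτ, H⟩ := h
  -- The cap at π/2 keeps the sine positive and monotone on [0, τ'].
  set τ' := min τ (Real.pi / 2) with hτ'
  have h0 : 0 < τ' := lt_min hτ (by positivity)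
  have h1 : τ' ≤ Real.pi / 2 := min_le_right _ _
  refine ⟨Real.sin τ', Real.sin_pos_of_pos_of_lt_pi h0 (by linarith [Real.pi_pos]),
    Real.sin_le_one _, fun v hv w hw => ?_⟩
  by_cases hv0 : v = 0
  · simp [hv0]
  by_cases hw0 : w = 0
  · simp [hw0]
  have a1 := H v ⟨hv, hv0⟩ w ⟨hw, hw0⟩
  -- Cones are symmetric, so π minus the angle is at least τ as well; this bounds the sine when the
  -- angle is obtuse.
  have a2 := H v ⟨hv, hv0⟩ (-w) ⟨Cone.neg_mem hw, by simpa using hw0⟩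
  rw [InnerProductGeometry.angle_neg_right] at a2
  rw [← sin_angle_mul_norm]
  gcongr
  have a3 : τ' ≤ τ := min_le_left _ _
  by_cases ha : InnerProductGeometry.angle v w ≤ Real.pi / 2
  · exact Real.sin_le_sin_of_le_of_le_pi_div_two (by linarith [Real.pi_pos]) ha (by linarith)
  · push Not at ha
    rw [← Real.sin_pi_sub (InnerProductGeometry.angle v w)]
    exact Real.sin_le_sin_of_le_of_le_pi_div_two (by linarith [Real.pi_pos]) (by linarith)
      (by linarith)

/-! ### Length of graphs in balls -/

section Graph

variable {d : ℕ} {C : Cone d} {γ : Set (EuclideanSpace ℝ (Fin d))}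

theorem Cone.abs_inner_le (C : Cone d) (x : EuclideanSpace ℝ (Fin d)) :
    |inner ℝ x C.e| ≤ ‖x‖ := by
  simpa [C.norm_e] using abs_real_inner_le_norm x C.e

/-- A limit point x shares its axial coordinate with some z in γ by maximality. The cone condition
is closed, so it passes to x - z, whose axial component vanishes; hence x = z. -/
theorem Cone.IsMaximalGraph.isClosed (h : C.IsMaximalGraph γ) : IsClosed γ := by
  refine isClosed_of_closure_subset fun x hx => ?_
  obtain ⟨z, hz, hzx⟩ := h.2 (inner ℝ x C.e)
  have hcl : IsClosed {w : EuclideanSpace ℝ (Fin d) | C.θ * ‖w - z‖ ≤ |inner ℝ (w - z) C.e|} :=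
    isClosed_le (by fun_prop) (by fun_prop)
  have hxz : C.θ * ‖x - z‖ ≤ |inner ℝ (x - z) C.e| :=
    closure_minimal (fun w hw => h.1 w hw z hz) hcl hx
  rw [inner_sub_left, hzx, sub_self, abs_zero] at hxz
  have : ‖x - z‖ ≤ 0 := by
    by_contra hc
    push Not at hc
    exact absurd hxz (not_le.2 (mul_pos C.θ_pos hc))
  rw [norm_le_zero_iff, sub_eq_zero] at this
  exact this ▸ hz

/-- The length of a graph in a ball is at most comparable to the radius. -/
theorem Cone.IsGraph.hausdorffMeasure_closedBall_le (h : C.IsGraph γ)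
    (x : EuclideanSpace ℝ (Fin d)) (r : ℝ) :
    Measure.hausdorffMeasure 1 (closedBall x r ∩ γ) ≤ ENNReal.ofReal (2 * r / C.θ) := by
  set S := closedBall x r ∩ γ
  set π : EuclideanSpace ℝ (Fin d) → ℝ := fun y => inner ℝ y C.e
  have hθ := C.θ_pos
  have hπ : ∀ y ∈ S, ∀ z ∈ S, dist y z ≤ (C.θ⁻¹.toNNReal : ℝ) * dist (π y) (π z) := by
    intro y hy z hz
    have : C.θ * ‖y - z‖ ≤ |inner ℝ (y - z) C.e| := h y hy.2 z hz.2
    rw [inner_sub_left] at this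
    rw [Real.coe_toNNReal _ (by positivity), dist_eq_norm, Real.dist_eq, inv_mul_eq_div,
      le_div_iff₀ hθ, mul_comm]
    exact this
  have hinj : InjOn π S := fun y hy z hz hyz => by
    have := hπ y hy z hz
    rw [hyz, dist_self, mul_zero] at this
    exact dist_le_zero.1 this
  have hleft : LeftInvOn (Function.invFunOn π S) π S := hinj.leftInvOn_invFunOn
  -- On a graph the projection to the axis has a θ⁻¹-Lipschitz inverse, so length is at most θ⁻¹
  -- times the length of the shadow.
  have hlip : LipschitzOnWith C.θ⁻¹.toNNReal (Function.invFunOn π S) (π '' S) := by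
    refine LipschitzOnWith.of_dist_le_mul ?_
    rintro _ ⟨y, hy, rfl⟩ _ ⟨z, hz, rfl⟩
    rw [hleft hy, hleft hz]
    exact hπ y hy z hz
  have himg : Function.invFunOn π S '' (π '' S) = S := hleft.image_image
  have hsub : π '' S ⊆ Icc (π x - r) (π x + r) := by
    rintro _ ⟨y, hy, rfl⟩
    have h1 : ‖y - x‖ ≤ r := by simpa [dist_eq_norm] using hy.1
    have h2 := (C.abs_inner_le (y - x)).trans h1
    rw [inner_sub_left, abs_le] at h2
    constructor <;> simp only [π] <;> linarith
  calc Measure.hausdorffMeasure 1 S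
      = Measure.hausdorffMeasure 1 (Function.invFunOn π S '' (π '' S)) := by rw [himg]
    _ ≤ (C.θ⁻¹.toNNReal : ℝ≥0∞) ^ (1 : ℝ) * Measure.hausdorffMeasure 1 (π '' S) :=
        hlip.hausdorffMeasure_image_le zero_le_one
    _ ≤ (C.θ⁻¹.toNNReal : ℝ≥0∞) * volume (Icc (π x - r) (π x + r)) := by
        rw [ENNReal.rpow_one, hausdorffMeasure_real]
        gcongr
    _ = ENNReal.ofReal (2 * r / C.θ) := by
        rw [Real.volume_Icc]
        change ENNReal.ofReal _ * _ = _
        rw [← ENNReal.ofReal_mul (by positivity)]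
        congr 1
        field_simp
        ring

/-- If a maximal graph passes through `y` and its part over a segment of the axis lies in `S`,
then it has at least the length of this segment in `S`. -/
theorem Cone.IsMaximalGraph.le_hausdorffMeasure (h : C.IsMaximalGraph γ)
    {y : EuclideanSpace ℝ (Fin d)} (hy : y ∈ γ) {S : Set (EuclideanSpace ℝ (Fin d))} {a b : ℝ}
    (hS : ∀ v ∈ C.carrier, inner ℝ v C.e ∈ Icc a b → y + v ∈ S) :
    ENNReal.ofReal (b - a) ≤ Measure.hausdorffMeasure 1 (S ∩ γ) := by
  set π : EuclideanSpace ℝ (Fin d) → ℝ := fun y => inner ℝ y C.e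
  have hlip : LipschitzWith 1 π := by
    refine LipschitzWith.of_dist_le_mul fun u v => ?_
    rw [NNReal.coe_one, one_mul, Real.dist_eq, dist_eq_norm, ← inner_sub_left]
    exact C.abs_inner_le _
  have hsub : Icc (π y + a) (π y + b) ⊆ π '' (S ∩ γ) := by
    intro t ht
    obtain ⟨z, hz, hzt⟩ := h.2 t
    refine ⟨z, ⟨?_, hz⟩, hzt⟩
    have := hS (z - y) (h.1 z hz y hy) (by
      rw [inner_sub_left, hzt]
      constructor <;> linarith [ht.1, ht.2])
    simpa using this
  calc ENNReal.ofReal (b - a) = volume (Icc (π y + a) (π y + b)) := by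
        rw [Real.volume_Icc]; congr 1; ring
    _ ≤ Measure.hausdorffMeasure 1 (π '' (S ∩ γ)) := by
        rw [hausdorffMeasure_real]; exact measure_mono hsub
    _ ≤ Measure.hausdorffMeasure 1 (S ∩ γ) := by
        simpa using hlip.hausdorffMeasure_image_le zero_le_one (S ∩ γ)

theorem Cone.norm_le_of_mem {v : EuclideanSpace ℝ (Fin d)} (hv : v ∈ C.carrier) {t : ℝ}
    (ht : |inner ℝ v C.e| ≤ C.θ * t) : ‖v‖ ≤ t :=
  le_of_mul_le_mul_left ((show C.θ * ‖v‖ ≤ _ from hv).trans ht) C.θ_pos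

/-- A maximal graph that meets a ball has a proportional length in the ball of twice the radius. -/
theorem Cone.IsMaximalGraph.le_hausdorffMeasure_ball_two (h : C.IsMaximalGraph γ)
    {x : EuclideanSpace ℝ (Fin d)} {r : ℝ} (hne : (ball x r ∩ γ).Nonempty) :
    ENNReal.ofReal (C.θ * r) ≤ Measure.hausdorffMeasure 1 (ball x (2 * r) ∩ γ) := by
  obtain ⟨y, hy, hyγ⟩ := hne
  have := h.le_hausdorffMeasure hyγ (S := ball x (2 * r)) (a := 0) (b := C.θ * r) ?_
  · simpa using this
  · intro v hv hvt
    have hn : ‖v‖ ≤ r := C.norm_le_of_mem hv (by rw [abs_of_nonneg hvt.1]; exact hvt.2)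
    rw [mem_ball, dist_eq_norm] at hy ⊢
    calc ‖y + v - x‖ = ‖(y - x) + v‖ := by congr 1; abel
      _ ≤ ‖y - x‖ + ‖v‖ := norm_add_le _ _
      _ < 2 * r := by linarith

end Graph

/-! ### Representations as integrals of length measures -/

section Rep

variable {d : ℕ} {μ : Measure (EuclideanSpace ℝ (Fin d))} {C : Cone d}
  {Ω : Type*} [MeasurableSpace Ω]

/-- The length measure on the graph `γ ω`. -/
noncomputable def AlbertiRep.curveMeasure (R : AlbertiRep μ C Ω) (ω : Ω) :
    Measure (EuclideanSpace ℝ (Fin d)) :=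
  (Measure.hausdorffMeasure 1).restrict (R.γ ω)

theorem AlbertiRep.curveMeasure_apply (R : AlbertiRep μ C Ω) (ω : Ω)
    (B : Set (EuclideanSpace ℝ (Fin d))) :
    R.curveMeasure ω B = Measure.hausdorffMeasure 1 (B ∩ R.γ ω) :=
  Measure.restrict_apply' (R.maximal ω).isClosed.measurableSet

theorem AlbertiRep.measurable_curveMeasure (R : AlbertiRep μ C Ω) :
    Measurable R.curveMeasure := by
  refine Measure.measurable_of_measurable_coe _ fun s hs => ?_
  simp only [R.curveMeasure_apply]
  exact R.measurable_hausdorff s hs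

theorem AlbertiRep.ν_apply (R : AlbertiRep μ C Ω) {B : Set (EuclideanSpace ℝ (Fin d))}
    (hB : MeasurableSet B) : R.ν B = ∫⁻ ω, R.curveMeasure ω B ∂ R.P :=
  Measure.bind_apply hB R.measurable_curveMeasure.aemeasurable

theorem AlbertiRep.lintegral_ν (R : AlbertiRep μ C Ω) {f : EuclideanSpace ℝ (Fin d) → ℝ≥0∞}
    (hf : Measurable f) : ∫⁻ x, f x ∂ R.ν = ∫⁻ ω, ∫⁻ x, f x ∂ R.curveMeasure ω ∂ R.P :=
  Measure.lintegral_bind R.measurable_curveMeasure.aemeasurable hf.aemeasurable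

theorem AlbertiRep.curveMeasure_closedBall_le (R : AlbertiRep μ C Ω) (ω : Ω)
    (x : EuclideanSpace ℝ (Fin d)) (r : ℝ) :
    R.curveMeasure ω (closedBall x r) ≤ ENNReal.ofReal (2 * r / C.θ) := by
  rw [R.curveMeasure_apply]
  exact (R.maximal ω).1.hausdorffMeasure_closedBall_le x r

instance (R : AlbertiRep μ C Ω) (ω : Ω) : IsLocallyFiniteMeasure (R.curveMeasure ω) :=
  ⟨fun x => ⟨closedBall x 1, closedBall_mem_nhds x one_pos,
    (R.curveMeasure_closedBall_le ω x 1).trans_lt ENNReal.ofReal_lt_top⟩⟩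

/-- Lengths in a unit ball are bounded uniformly in ω and P is finite. The resulting σ-finiteness of
ν is what Radon–Nikodym and Fubini need later. -/
instance (R : AlbertiRep μ C Ω) : IsLocallyFiniteMeasure R.ν := by
  refine ⟨fun x => ⟨closedBall x 1, closedBall_mem_nhds x one_pos, ?_⟩⟩
  have := R.finite_P
  rw [R.ν_apply measurableSet_closedBall]
  calc ∫⁻ ω, R.curveMeasure ω (closedBall x 1) ∂ R.P
      ≤ ∫⁻ _, ENNReal.ofReal (2 * 1 / C.θ) ∂ R.P :=
        lintegral_mono fun ω => R.curveMeasure_closedBall_le ω x 1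
    _ < ∞ := by
        rw [lintegral_const]
        exact ENNReal.mul_lt_top ENNReal.ofReal_lt_top (measure_lt_top _ _)

/-- A bounded above representation dominates the measure. -/
theorem AlbertiRep.BoAOn.exists_restrict_le [SigmaFinite μ] {R : AlbertiRep μ C Ω}
    {B : Set (EuclideanSpace ℝ (Fin d))} (h : R.BoAOn B) (hB : MeasurableSet B) :
    ∃ M : ℝ≥0, μ.restrict B ≤ (M : ℝ≥0∞) • R.ν.restrict B := by
  have hfin : eLpNormEssSup R.density (R.ν.restrict B) < ∞ := by
    simpa using h.eLpNorm_lt_top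
  refine ⟨(eLpNormEssSup R.density (R.ν.restrict B)).toNNReal, ?_⟩
  rw [ENNReal.coe_toNNReal hfin.ne]
  refine Measure.le_iff.2 fun s hs => ?_
  have hac : μ ≪ R.ν := R.absolutelyContinuous
  rw [Measure.restrict_apply hs, ← Measure.setLIntegral_rnDeriv hac, Measure.smul_apply,
    smul_eq_mul, Measure.restrict_apply hs, ← setLIntegral_const]
  refine setLIntegral_mono_ae' (hs.inter hB) ?_
  have hae := ae_le_eLpNormEssSup (f := R.density) (μ := R.ν.restrict B)
  rw [ae_restrict_iff' hB] at hae
  filter_upwards [hae] with x hx hxs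
  simpa [AlbertiRep.density] using hx hxs.2

/-- A bounded below representation is dominated by the measure. -/
theorem AlbertiRep.BoBOn.exists_restrict_le [SigmaFinite μ] {R : AlbertiRep μ C Ω}
    {B : Set (EuclideanSpace ℝ (Fin d))} (h : R.BoBOn B) (hB : MeasurableSet B) :
    ∃ M : ℝ≥0, R.ν.restrict B ≤ (M : ℝ≥0∞) • μ.restrict B := by
  set N := eLpNormEssSup (fun x => (R.density x)⁻¹) (R.ν.restrict B) with hN
  have hfin : N < ∞ := by
    simpa using h.eLpNorm_lt_top
  refine ⟨N.toNNReal, ?_⟩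
  rw [ENNReal.coe_toNNReal hfin.ne]
  refine Measure.le_iff.2 fun s hs => ?_
  have hac : μ ≪ R.ν := R.absolutelyContinuous
  rw [Measure.smul_apply, smul_eq_mul, Measure.restrict_apply hs, Measure.restrict_apply hs,
    ← Measure.setLIntegral_rnDeriv hac, ← lintegral_const_mul _ (Measure.measurable_rnDeriv _ _),
    ← setLIntegral_one]
  refine setLIntegral_mono_ae' (hs.inter hB) ?_
  have hae := ae_le_eLpNormEssSup (f := fun x => (R.density x)⁻¹) (μ := R.ν.restrict B)
  rw [ae_restrict_iff' hB] at hae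
  filter_upwards [hae, Measure.rnDeriv_lt_top μ R.ν] with x hx hx' hxs
  have h1 : (R.density x)⁻¹ ≤ N := by simpa using hx hxs.2
  change 1 ≤ N * R.density x
  -- The convention 0⁻¹ = ∞ matters: a bounded inverse excludes zeros of the density, so ν is
  -- dominated by μ.
  have h0 : R.density x ≠ 0 := fun h0 => by
    rw [h0, ENNReal.inv_zero] at h1
    exact absurd (top_le_iff.1 h1) hfin.ne
  rw [← ENNReal.div_le_iff_le_mul (Or.inl h0) (Or.inl hx'.ne), one_div]
  exact h1

/-- The mass of the graphs that meet a ball is controlled by the measure of the double ball. -/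
theorem AlbertiRep.mul_measure_hit_le (R : AlbertiRep μ C Ω) (x : EuclideanSpace ℝ (Fin d))
    (r : ℝ) :
    ENNReal.ofReal (C.θ * r) * R.P {ω | R.curveMeasure ω (ball x r) ≠ 0} ≤
      R.ν (ball x (2 * r)) := by
  have hmeas : MeasurableSet {ω | R.curveMeasure ω (ball x r) ≠ 0} :=
    (measurableSet_singleton 0).compl.preimage
      ((Measure.measurable_coe measurableSet_ball).comp R.measurable_curveMeasure)
  rw [R.ν_apply measurableSet_ball, ← setLIntegral_const]
  refine (setLIntegral_mono' hmeas fun ω hω => ?_).trans (setLIntegral_le_lintegral _ _)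
  rw [R.curveMeasure_apply]
  refine (R.maximal ω).le_hausdorffMeasure_ball_two ?_
  have h1 : R.curveMeasure ω (ball x r) ≠ 0 := hω
  rw [R.curveMeasure_apply] at h1
  exact nonempty_of_measure_ne_zero h1

end Rep

/-! ### Visible directions and the doubling property -/

section Doubling

/-- The points that a cone sees from `x` under a definite angle to the orthogonal direction. -/
def visibleSet {d : ℕ} (C : Cone d) (c : ℝ) (x : EuclideanSpace ℝ (Fin d)) :
    Set (EuclideanSpace ℝ (Fin d)) :=
  {y | ∀ v ∈ C.carrier, c * (‖v‖ * ‖y - x‖) ≤ |inner ℝ v (y - x)|}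

theorem isClosed_visibleSet {d : ℕ} (C : Cone d) (c : ℝ) (x : EuclideanSpace ℝ (Fin d)) :
    IsClosed (visibleSet C c x) := by
  have : visibleSet C c x =
      ⋂ v ∈ C.carrier, {y | c * (‖v‖ * ‖y - x‖) ≤ |inner ℝ v (y - x)|} := by
    ext y; simp [visibleSet]
  rw [this]
  exact isClosed_biInter fun v _ => isClosed_le (by fun_prop) (by fun_prop)

/-- In the plane, vectors v and w both nearly orthogonal to y - x would be nearly parallel to each
other, which transversality forbids. -/
theorem visibleSet_union {C₁ C₂ : Cone 2} {κ : ℝ}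
    (hκ : ∀ v ∈ C₁.carrier, ∀ w ∈ C₂.carrier, κ * (‖v‖ * ‖w‖) ≤ |cross v w|)
    (x : EuclideanSpace ℝ (Fin 2)) :
    visibleSet C₁ (κ / 2) x ∪ visibleSet C₂ (κ / 2) x = univ := by
  rw [eq_univ_iff_forall]
  intro y
  by_contra hy
  simp only [visibleSet, mem_union, mem_ofPred_eq, not_or, not_forall, not_le] at hy
  obtain ⟨⟨v, hv, hvy⟩, ⟨w, hw, hwy⟩⟩ := hy
  set z := y - x
  -- Expansion of v × w in the orthogonal frame given by z and its rotation. If both inner products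
  -- are below κ/2 times the norms, the right side is smaller than κ‖z‖²‖v‖‖w‖.
  have hid : ‖z‖ ^ 2 * cross v w = inner ℝ v z * cross z w - inner ℝ w z * cross z v := by
    rw [norm_sq_eq_two, inner_eq_two, inner_eq_two, cross, cross, cross]; ring
  have h1 : ‖z‖ ^ 2 * |cross v w| ≤
      |inner ℝ v z| * (‖z‖ * ‖w‖) + |inner ℝ w z| * (‖z‖ * ‖v‖) := by
    calc ‖z‖ ^ 2 * |cross v w| = |‖z‖ ^ 2 * cross v w| := by
          rw [abs_mul, abs_of_nonneg (sq_nonneg ‖z‖)]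
      _ ≤ |inner ℝ v z * cross z w| + |inner ℝ w z * cross z v| := by
          rw [hid]; exact abs_sub _ _
      _ ≤ _ := by
          rw [abs_mul, abs_mul]
          gcongr <;> exact abs_cross_le _ _
  have hz : 0 < ‖z‖ := by
    rw [norm_pos_iff]; rintro h0; simp [h0] at hvy
  have hw0 : 0 < ‖w‖ := by
    rw [norm_pos_iff]; rintro h0; simp [h0] at hwy
  have hv0 : 0 < ‖v‖ := by
    rw [norm_pos_iff]; rintro h0; simp [h0] at hvy
  have h2 := mul_lt_mul_of_pos_right hvy (mul_pos hz hw0)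
  have h3 := mul_lt_mul_of_pos_right hwy (mul_pos hz hv0)
  have h4 := mul_le_mul_of_nonneg_left (hκ v hv w hw) (sq_nonneg ‖z‖)
  nlinarith

/-- Half of a cone lies on one side of the line orthogonal to a visible direction. -/
theorem inner_le_of_mem_visibleSet {d : ℕ} {C : Cone d} {c : ℝ} (hc : 0 < c)
    {x y : EuclideanSpace ℝ (Fin d)} (hy : y ∈ visibleSet C c x) (hxy : y ≠ x) :
    ∃ σ : ℝ, (σ = 1 ∨ σ = -1) ∧ ∀ v ∈ C.carrier, 0 < σ * inner ℝ v C.e →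
      inner ℝ v (y - x) ≤ -(c * (‖v‖ * ‖y - x‖)) := by
  set z := y - x with hz
  have hz0 : 0 < ‖z‖ := norm_pos_iff.2 (sub_ne_zero.2 hxy)
  have he : C.e ∈ C.carrier := by
    simp [Cone.carrier, C.norm_e, C.θ_le_one]
  -- If v lay in the same half-cone as f but on the other side of the line orthogonal to z, a
  -- positive combination of v and f would be a nonzero cone vector orthogonal to z, contradicting
  -- visibility.
  have key : ∀ f ∈ C.carrier, inner ℝ f z < 0 → (∀ v ∈ C.carrier, 0 < inner ℝ v f →
      ∀ a b : ℝ, 0 < a → 0 < b → a • v + b • f ∈ C.carrier ∧ a • v + b • f ≠ 0) →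
      ∀ v ∈ C.carrier, 0 < inner ℝ v f → inner ℝ v z ≤ -(c * (‖v‖ * ‖z‖)) := by
    intro f hf hfz hconv v hv hvf
    have hvz := hy v hv
    rcases le_abs'.1 hvz with h | h
    · linarith
    · exfalso
      have hv0 : v ≠ 0 := by rintro rfl; simp at hvf
      have hpos : 0 < inner ℝ v z :=
        lt_of_lt_of_le (by have := norm_pos_iff.2 hv0; positivity) h
      obtain ⟨hw, hw0⟩ := hconv v hv hvf (-inner ℝ f z) (inner ℝ v z) (by linarith) hpos
      have h2 := hy _ hw
      have h3 : inner ℝ ((-inner ℝ f z) • v + (inner ℝ v z) • f) z = 0 := by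
        rw [inner_add_left, real_inner_smul_left, real_inner_smul_left]; ring
      rw [← hz, h3, abs_zero] at h2
      have := norm_pos_iff.2 hw0
      have : 0 < c * (‖(-inner ℝ f z) • v + (inner ℝ v z) • f‖ * ‖z‖) := by positivity
      linarith
  -- Each half of the cone is stable under adding positive multiples of its axis vector.
  have hconv : ∀ σ : ℝ, (σ = 1 ∨ σ = -1) → ∀ v ∈ C.carrier, 0 < inner ℝ v (σ • C.e) →
      ∀ a b : ℝ, 0 < a → 0 < b →
      a • v + b • (σ • C.e) ∈ C.carrier ∧ a • v + b • (σ • C.e) ≠ 0 := by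
    intro σ hσ v hv hvf a b ha hb
    have hσ2 : σ * σ = 1 := by rcases hσ with rfl | rfl <;> norm_num
    have hσa : |σ| = 1 := by rcases hσ with rfl | rfl <;> norm_num
    rw [real_inner_smul_right] at hvf
    have hee : inner ℝ C.e C.e = (1 : ℝ) := by rw [real_inner_self_eq_norm_sq, C.norm_e]; norm_num
    have hi : inner ℝ (a • v + b • (σ • C.e)) C.e = σ * (a * (σ * inner ℝ v C.e) + b) := by
      rw [inner_add_left, real_inner_smul_left, real_inner_smul_left, real_inner_smul_left, hee]
      linear_combination (-a * inner ℝ v C.e) * hσ2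
    have hpos : 0 < a * (σ * inner ℝ v C.e) + b := by positivity
    have hia : |inner ℝ (a • v + b • (σ • C.e)) C.e| = a * (σ * inner ℝ v C.e) + b := by
      rw [hi, abs_mul, hσa, one_mul, abs_of_pos hpos]
    have hva : |inner ℝ v C.e| = σ * inner ℝ v C.e := by
      rw [← abs_of_pos hvf, abs_mul, hσa, one_mul]
    refine ⟨?_, ?_⟩
    · change C.θ * ‖_‖ ≤ _
      rw [hia]
      have hv' : C.θ * ‖v‖ ≤ |inner ℝ v C.e| := hv
      rw [hva] at hv'
      have hn : ‖a • v + b • (σ • C.e)‖ ≤ a * ‖v‖ + b := by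
        refine (norm_add_le _ _).trans ?_
        rw [norm_smul, norm_smul, norm_smul, C.norm_e, Real.norm_eq_abs, Real.norm_eq_abs,
          Real.norm_eq_abs, hσa, abs_of_pos ha, abs_of_pos hb]
        simp
      have := mul_le_mul_of_nonneg_left hn C.θ_pos.le
      nlinarith [C.θ_le_one]
    · intro h0
      rw [h0, inner_zero_left, abs_zero] at hia
      linarith
  have hez := hy _ he
  rw [C.norm_e, one_mul, ← hz] at hez
  have hcz : 0 < c * ‖z‖ := by positivity
  rcases le_abs'.1 hez with h | h
  · refine ⟨1, Or.inl rfl, fun v hv hv1 => ?_⟩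
    have := key ((1 : ℝ) • C.e) (by simpa using he) (by rw [one_smul]; linarith)
      (hconv 1 (Or.inl rfl)) v hv (by simpa using hv1)
    exact this
  · refine ⟨-1, Or.inr rfl, fun v hv hv1 => ?_⟩
    have := key ((-1 : ℝ) • C.e) (by simpa using Cone.neg_mem he)
      (by rw [real_inner_smul_left]; linarith)
      (hconv (-1) (Or.inr rfl)) v hv (by rw [real_inner_smul_right]; exact hv1)
    exact this

end Doubling

/-- A maximal graph through a visible point of a ball has a definite length in a concentric
smaller ball. -/
theorem Cone.IsMaximalGraph.le_hausdorffMeasure_ball_of_visible {d : ℕ} {C : Cone d}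
    {γ : Set (EuclideanSpace ℝ (Fin d))} (h : C.IsMaximalGraph γ) {c : ℝ} (hc : 0 < c)
    (hc1 : c ≤ 1) {ρ : ℝ} (hρ : 0 < ρ) (hρc : 1 - c ^ 2 * C.θ / 8 ≤ ρ ^ 2)
    {x : EuclideanSpace ℝ (Fin d)} {r : ℝ} (hr : 0 < r)
    (hne : (visibleSet C c x ∩ ball x r ∩ γ).Nonempty) :
    ENNReal.ofReal (C.θ * c / 4 * r) ≤ Measure.hausdorffMeasure 1 (ball x (ρ * r) ∩ γ) := by
  obtain ⟨y, ⟨hyv, hyb⟩, hyγ⟩ := hne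
  have hθ := C.θ_pos
  have hθ1 := C.θ_le_one
  have hc2 : c ^ 2 ≤ 1 := by nlinarith
  have hcθ : c ^ 2 * C.θ ≤ 1 := by nlinarith [sq_nonneg c]
  rw [mem_ball, dist_eq_norm] at hyb
  -- Near the centre a short piece of graph in either direction stays in the ball of radius 3r/4,
  -- and ρ ≥ 3/4.
  by_cases hyr : ‖y - x‖ < r / 2
  · have := h.le_hausdorffMeasure hyγ (S := ball x (ρ * r)) (a := 0) (b := C.θ * c / 4 * r) ?_
    · simpa using this
    intro v hv hvt
    have hn : ‖v‖ ≤ c / 4 * r :=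
      C.norm_le_of_mem hv (by rw [abs_of_nonneg hvt.1]; linarith [hvt.2])
    have hn' : ‖v‖ ≤ r / 4 := by nlinarith
    have hρ' : 3 / 4 ≤ ρ := by nlinarith
    rw [mem_ball, dist_eq_norm]
    calc ‖y + v - x‖ = ‖(y - x) + v‖ := by congr 1; abel
      _ ≤ ‖y - x‖ + ‖v‖ := norm_add_le _ _
      _ < 3 / 4 * r := by linarith
      _ ≤ ρ * r := by gcongr
  · push Not at hyr
    have hxy : y ≠ x := by
      rintro rfl
      simp at hyr
      linarith
    obtain ⟨σ, hσ, H⟩ := inner_le_of_mem_visibleSet hc hyv hxy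
    -- Follow the graph along the half-cone that points inwards. With n = ‖v‖ ≤ cr/2 ≤ cm, where m =
    -- ‖y - x‖, the squared distance to x is at most m² - 2cnm + n² ≤ m² - cnm. Since n ≥ θcr/4 and
    -- m ≥ r/2, the gain is at least c²θr²/8, which is the condition on ρ.
    have move : ∀ v ∈ C.carrier, σ * inner ℝ v C.e ∈ Icc (C.θ * c / 4 * r) (C.θ * c / 2 * r) →
        y + v ∈ ball x (ρ * r) := by
      intro v hv hvt
      have hpos : 0 < C.θ * c / 4 * r := by positivity
      have hI := H v hv (hpos.trans_le hvt.1)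
      have habs : |inner ℝ v C.e| = σ * inner ℝ v C.e := by
        rw [← abs_of_pos (hpos.trans_le hvt.1), abs_mul]
        rcases hσ with rfl | rfl <;> simp
      have hn : ‖v‖ ≤ c / 2 * r := C.norm_le_of_mem hv (by rw [habs]; linarith [hvt.2])
      have hlow : C.θ * c / 4 * r ≤ ‖v‖ := hvt.1.trans (habs ▸ C.abs_inner_le v)
      rw [mem_ball, dist_eq_norm, show y + v - x = (y - x) + v by abel]
      refine lt_of_pow_lt_pow_left₀ 2 (by positivity) ?_
      rw [norm_add_sq_real, real_inner_comm]
      set n := ‖v‖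
      set m := ‖y - x‖
      have e1 : n ≤ c * m := by nlinarith
      have e2 : n ^ 2 ≤ c * (n * m) := by nlinarith [norm_nonneg v]
      have e3 : c ^ 2 * C.θ / 8 * r ^ 2 ≤ c * (n * m) := by
        have : (C.θ * c / 4 * r) * (r / 2) ≤ n * m := by gcongr
        nlinarith
      have e4 : m ^ 2 < r ^ 2 := by gcongr
      have e5 : (1 - c ^ 2 * C.θ / 8) * r ^ 2 ≤ ρ ^ 2 * r ^ 2 := by gcongr
      nlinarith
    rcases hσ with rfl | rfl
    · have := h.le_hausdorffMeasure hyγ (S := ball x (ρ * r)) (a := C.θ * c / 4 * r)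
        (b := C.θ * c / 2 * r) fun v hv hvt => move v hv (by simpa using hvt)
      convert this using 2
      ring
    · have := h.le_hausdorffMeasure hyγ (S := ball x (ρ * r)) (a := -(C.θ * c / 2 * r))
        (b := -(C.θ * c / 4 * r)) fun v hv hvt => move v hv
          ⟨by linarith [hvt.2], by linarith [hvt.1]⟩
      convert this using 2
      ring

/-- The visible part of a ball is controlled by a smaller concentric ball. -/
theorem AlbertiRep.ν_visibleSet_le {d : ℕ} {μ : Measure (EuclideanSpace ℝ (Fin d))} {C : Cone d}
    {Ω : Type*} [MeasurableSpace Ω] (R : AlbertiRep μ C Ω) {c : ℝ} (hc : 0 < c)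
    (hc1 : c ≤ 1) {ρ : ℝ} (hρ : 0 < ρ) (hρc : 1 - c ^ 2 * C.θ / 8 ≤ ρ ^ 2)
    (x : EuclideanSpace ℝ (Fin d)) {r : ℝ} (hr : 0 < r) :
    R.ν (visibleSet C c x ∩ ball x r) ≤
      ENNReal.ofReal (8 / (C.θ ^ 2 * c)) * R.ν (ball x (ρ * r)) := by
  have hm : MeasurableSet (visibleSet C c x ∩ ball x r) :=
    (isClosed_visibleSet C c x).measurableSet.inter measurableSet_ball
  have hθ := C.θ_pos
  rw [R.ν_apply hm, R.ν_apply measurableSet_ball, ← lintegral_const_mul]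
  · refine lintegral_mono fun ω => ?_
    rcases (visibleSet C c x ∩ ball x r ∩ R.γ ω).eq_empty_or_nonempty with he | hne
    · rw [R.curveMeasure_apply, he, measure_empty]; exact zero_le
    calc R.curveMeasure ω (visibleSet C c x ∩ ball x r)
        ≤ R.curveMeasure ω (closedBall x r) :=
          measure_mono (inter_subset_right.trans ball_subset_closedBall)
      _ ≤ ENNReal.ofReal (2 * r / C.θ) := R.curveMeasure_closedBall_le ω x r
      -- The constant is the ratio of the maximal length 2r/θ to the guaranteed length θcr/4.
      _ = ENNReal.ofReal (8 / (C.θ ^ 2 * c)) * ENNReal.ofReal (C.θ * c / 4 * r) := by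
          rw [← ENNReal.ofReal_mul (by positivity)]
          congr 1
          field_simp
          ring
      _ ≤ _ := by
          gcongr
          rw [R.curveMeasure_apply]
          exact (R.maximal ω).le_hausdorffMeasure_ball_of_visible hc hc1 hρ hρc hr hne
  · exact (Measure.measurable_coe measurableSet_ball).comp R.measurable_curveMeasure

theorem restrict_le_apply {α : Type*} [MeasurableSpace α] {m₁ m₂ : Measure α} {B S : Set α}
    {M : ℝ≥0∞} (h : m₁.restrict B ≤ M • m₂.restrict B) (hS : S ⊆ B) :
    m₁ S ≤ M * m₂ S := by
  have := h S
  rwa [Measure.restrict_eq_self _ hS, Measure.smul_apply, Measure.restrict_eq_self _ hS] at this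

/-- A measure that is comparable to the measures of two independent representations is doubling. -/
theorem exists_doubling {μ : Measure (EuclideanSpace ℝ (Fin 2))} {C₁ C₂ : Cone 2}
    (hC : C₁.Independent C₂) {Ω₁ Ω₂ : Type*} [MeasurableSpace Ω₁] [MeasurableSpace Ω₂]
    (R₁ : AlbertiRep μ C₁ Ω₁) (R₂ : AlbertiRep μ C₂ Ω₂) {U : Set (EuclideanSpace ℝ (Fin 2))}
    {M : ℝ≥0}
    (hA₁ : μ.restrict U ≤ (M : ℝ≥0∞) • R₁.ν.restrict U)
    (hA₂ : μ.restrict U ≤ (M : ℝ≥0∞) • R₂.ν.restrict U)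
    (hB₁ : R₁.ν.restrict U ≤ (M : ℝ≥0∞) • μ.restrict U)
    (hB₂ : R₂.ν.restrict U ≤ (M : ℝ≥0∞) • μ.restrict U) :
    ∃ A : ℝ≥0, ∀ (x : EuclideanSpace ℝ (Fin 2)) (r : ℝ), 0 < r → ball x (2 * r) ⊆ U →
      μ (ball x (2 * r)) ≤ A * μ (ball x r) := by
  obtain ⟨κ, hκ0, hκ1, hκ⟩ := hC.exists_cross
  set c := κ / 2 with hc
  have hc0 : 0 < c := by positivity
  have hc1 : c ≤ 1 := by linarith
  obtain ⟨ρ, hρ0, hρ1, hρ₁, hρ₂⟩ : ∃ ρ : ℝ, 0 < ρ ∧ ρ < 1 ∧ 1 - c ^ 2 * C₁.θ / 8 ≤ ρ ^ 2 ∧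
      1 - c ^ 2 * C₂.θ / 8 ≤ ρ ^ 2 := by
    set s := min (c ^ 2 * C₁.θ / 8) (c ^ 2 * C₂.θ / 8) with hs
    have h1 := C₁.θ_pos
    have h2 := C₂.θ_pos
    have hs0 : 0 < s := lt_min (by positivity) (by positivity)
    have hs1 : s ≤ 1 / 8 := (min_le_left _ _).trans (by
      have := C₁.θ_le_one
      have hc2 : c ^ 2 ≤ 1 := by nlinarith
      nlinarith [sq_nonneg c])
    refine ⟨Real.sqrt (1 - s), Real.sqrt_pos.2 (by linarith),
      (Real.sqrt_lt' one_pos).2 (by linarith), ?_, ?_⟩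
    · rw [Real.sq_sqrt (by linarith)]; linarith [min_le_left (c ^ 2 * C₁.θ / 8) (c ^ 2 * C₂.θ / 8)]
    · rw [Real.sq_sqrt (by linarith)]; linarith [min_le_right (c ^ 2 * C₁.θ / 8) (c ^ 2 * C₂.θ / 8)]
  set K : ℝ≥0 := M * Real.toNNReal (8 / (C₁.θ ^ 2 * c)) * M +
    M * Real.toNNReal (8 / (C₂.θ ^ 2 * c)) * M with hK
  -- On the part visible to each cone, pass from μ to ν of that cone, shrink the ball there, and
  -- return to μ.
  have one : ∀ (x : EuclideanSpace ℝ (Fin 2)) (r : ℝ), 0 < r → ball x r ⊆ U →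
      μ (ball x r) ≤ K * μ (ball x (ρ * r)) := by
    intro x r hr hU
    have hU' : ball x (ρ * r) ⊆ U := (ball_subset_ball (by nlinarith)).trans hU
    have hcov : ball x r ⊆ (visibleSet C₁ c x ∩ ball x r) ∪ (visibleSet C₂ c x ∩ ball x r) := by
      rw [← union_inter_distrib_right, visibleSet_union hκ, univ_inter]
    have b₁ : μ (visibleSet C₁ c x ∩ ball x r) ≤
        (M * Real.toNNReal (8 / (C₁.θ ^ 2 * c)) * M : ℝ≥0) * μ (ball x (ρ * r)) := by
      calc _ ≤ M * R₁.ν (visibleSet C₁ c x ∩ ball x r) :=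
            restrict_le_apply hA₁ (inter_subset_right.trans hU)
        _ ≤ M * (ENNReal.ofReal (8 / (C₁.θ ^ 2 * c)) * R₁.ν (ball x (ρ * r))) := by
            gcongr; exact R₁.ν_visibleSet_le hc0 hc1 hρ0 hρ₁ x hr
        _ ≤ M * (ENNReal.ofReal (8 / (C₁.θ ^ 2 * c)) * (M * μ (ball x (ρ * r)))) := by
            gcongr; exact restrict_le_apply hB₁ hU'
        _ = _ := by push_cast; rw [ENNReal.ofReal]; ring
    have b₂ : μ (visibleSet C₂ c x ∩ ball x r) ≤
        (M * Real.toNNReal (8 / (C₂.θ ^ 2 * c)) * M : ℝ≥0) * μ (ball x (ρ * r)) := by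
      calc _ ≤ M * R₂.ν (visibleSet C₂ c x ∩ ball x r) :=
            restrict_le_apply hA₂ (inter_subset_right.trans hU)
        _ ≤ M * (ENNReal.ofReal (8 / (C₂.θ ^ 2 * c)) * R₂.ν (ball x (ρ * r))) := by
            gcongr; exact R₂.ν_visibleSet_le hc0 hc1 hρ0 hρ₂ x hr
        _ ≤ M * (ENNReal.ofReal (8 / (C₂.θ ^ 2 * c)) * (M * μ (ball x (ρ * r)))) := by
            gcongr; exact restrict_le_apply hB₂ hU'
        _ = _ := by push_cast; rw [ENNReal.ofReal]; ring
    calc μ (ball x r) ≤ _ := measure_mono hcov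
      _ ≤ _ := measure_union_le _ _
      _ ≤ _ := add_le_add b₁ b₂
      _ = _ := by rw [hK, ENNReal.coe_add, add_mul]
  have iter : ∀ (n : ℕ) (x : EuclideanSpace ℝ (Fin 2)) (r : ℝ), 0 < r → ball x r ⊆ U →
      μ (ball x r) ≤ (K ^ n : ℝ≥0) * μ (ball x (ρ ^ n * r)) := by
    intro n x r hr hU
    induction n with
    | zero => simp
    | succ n ih =>
      refine ih.trans ?_
      have hsub : ball x (ρ ^ n * r) ⊆ U :=
        (ball_subset_ball (by
          have := pow_le_one₀ hρ0.le hρ1.le (n := n); nlinarith)).trans hU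
      calc _ ≤ ((K ^ n : ℝ≥0) : ℝ≥0∞) * (K * μ (ball x (ρ * (ρ ^ n * r)))) := by
            gcongr; exact one x _ (by positivity) hsub
        _ = _ := by
            rw [show ρ * (ρ ^ n * r) = ρ ^ (n + 1) * r by ring]
            push_cast; ring
  -- Enough shrinkings by ρ to go from radius 2r below radius r.
  obtain ⟨n, hn⟩ := exists_pow_lt_of_lt_one (show (0 : ℝ) < 1 / 2 by norm_num) hρ1
  refine ⟨K ^ n, fun x r hr hU => (iter n x (2 * r) (by positivity) hU).trans ?_⟩
  gcongr
  nlinarith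

/-! ### From L² bounds on averages to an L² density -/

section L2

variable {d : ℕ}

theorem measurable_measure_inter_closedBall (m : Measure (EuclideanSpace ℝ (Fin d))) [SFinite m]
    (δ : ℝ) : Measurable fun x => m (closedBall x δ) := by
  have hT : MeasurableSet {p : EuclideanSpace ℝ (Fin d) × EuclideanSpace ℝ (Fin d) |
      dist p.2 p.1 ≤ δ} := (isClosed_le (by fun_prop) (by fun_prop)).measurableSet
  exact measurable_measure_prodMk_left hT

/-- Averaging over balls of radius `δ` and Fubini. -/
theorem lintegral_lintegral_closedBall (m n : Measure (EuclideanSpace ℝ (Fin d))) [SFinite m]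
    [SFinite n] {g : EuclideanSpace ℝ (Fin d) → ℝ≥0∞} (hg : Measurable g) (δ : ℝ) :
    ∫⁻ x, ∫⁻ y in closedBall x δ, g y ∂m ∂n = ∫⁻ y, g y * n (closedBall y δ) ∂m := by
  have hT : MeasurableSet {p : EuclideanSpace ℝ (Fin d) × EuclideanSpace ℝ (Fin d) |
      dist p.2 p.1 ≤ δ} := (isClosed_le (by fun_prop) (by fun_prop)).measurableSet
  have h1 : ∀ x, ∫⁻ y in closedBall x δ, g y ∂m =
      ∫⁻ y, {p : EuclideanSpace ℝ (Fin d) × EuclideanSpace ℝ (Fin d) |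
        dist p.2 p.1 ≤ δ}.indicator (fun p => g p.2) (x, y) ∂m := by
    intro x
    rw [← lintegral_indicator measurableSet_closedBall]
    rfl
  simp_rw [h1]
  rw [lintegral_lintegral_swap]
  · refine lintegral_congr fun y => ?_
    have : ∀ x, {p : EuclideanSpace ℝ (Fin d) × EuclideanSpace ℝ (Fin d) |
        dist p.2 p.1 ≤ δ}.indicator (fun p => g p.2) (x, y) =
        (closedBall y δ).indicator (fun _ => g y) x := by
      intro x
      simp only [indicator, mem_ofPred_eq, mem_closedBall, dist_comm]
    simp_rw [this]
    rw [lintegral_indicator measurableSet_closedBall, setLIntegral_const]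
  · exact ((hg.comp measurable_snd).indicator hT).aemeasurable

/-- If the averages of `m` over balls are bounded in `L²`, then so is the density of `m`. -/
theorem lintegral_rnDeriv_sq_le_of_average (m : Measure (EuclideanSpace ℝ (Fin d)))
    [IsLocallyFiniteMeasure m] {K : ℝ≥0∞}
    (h : ∀ δ : ℝ, 0 < δ → ∫⁻ x, (m (closedBall x δ) / volume (closedBall x δ)) ^ 2 ≤ K) :
    ∫⁻ x, m.rnDeriv volume x ^ 2 ≤ K := by
  -- Differentiation of measures along these radii, followed by Fatou.
  set u : ℕ → ℝ := fun n => 1 / ((n : ℝ) + 1)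
  have hu0 : ∀ n, 0 < u n := fun n => by positivity
  have hu : Filter.Tendsto u Filter.atTop (nhdsWithin 0 (Ioi 0)) :=
    tendsto_nhdsWithin_iff.2 ⟨tendsto_one_div_add_atTop_nhds_zero_nat,
      Filter.Eventually.of_forall hu0⟩
  have hae : ∀ᵐ x, m.rnDeriv volume x ^ 2 = Filter.liminf
      (fun n => (m (closedBall x (u n)) / volume (closedBall x (u n))) ^ 2) Filter.atTop := by
    filter_upwards [Besicovitch.ae_tendsto_rnDeriv m volume] with x hx
    exact (((ENNReal.continuous_pow 2).tendsto _).comp (hx.comp hu)).liminf_eq.symm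
  rw [lintegral_congr_ae hae]
  refine (lintegral_liminf_le fun n => ?_).trans ?_
  · exact ((measurable_measure_inter_closedBall m _).div
      (measurable_measure_inter_closedBall volume _)).pow_const 2
  · refine Filter.liminf_le_of_le (by isBoundedDefault) fun b hb => ?_
    obtain ⟨n, hn⟩ := hb.exists
    exact hn.trans (h _ (hu0 n))

/-- If the averages of `m` over balls are bounded in `L²`, then `m` is absolutely continuous. -/
theorem absolutelyContinuous_of_average (m : Measure (EuclideanSpace ℝ (Fin d)))
    [IsLocallyFiniteMeasure m] {K : ℝ≥0∞} (hK : K ≠ ∞)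
    (h : ∀ δ : ℝ, 0 < δ → ∫⁻ x, (m (closedBall x δ) / volume (closedBall x δ)) ^ 2 ≤ K) :
    m ≪ volume := by
  -- The derivative does not see a singular part, so absolute continuity needs its own argument.
  -- Inner regularity reduces it to compact null sets.
  have compact_case : ∀ S : Set (EuclideanSpace ℝ (Fin d)), IsCompact S → volume S = 0 →
      m S = 0 := by
    intro S hS hS0
    have bound : ∀ t : ℝ≥0, 0 < t → m S ≤ t * (K + 1) := by
      intro t ht
      have ht0 : (t : ℝ≥0∞) ≠ 0 := by simpa using ht.ne'
      obtain ⟨W, hSW, hW, hWv⟩ := S.exists_isOpen_lt_of_lt (μ := volume) ((t : ℝ≥0∞) ^ 2)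
        (by rw [hS0]; positivity)
      obtain ⟨δ, hδ, hδW⟩ := hS.exists_cthickening_subset_open hW hSW
      set V := volume (closedBall (0 : EuclideanSpace ℝ (Fin d)) δ) with hV
      have hVx : ∀ x : EuclideanSpace ℝ (Fin d), volume (closedBall x δ) = V := fun x =>
        Measure.addHaar_closedBall_center _ _ _
      have hV0 : V ≠ 0 := (measure_closedBall_pos _ _ hδ).ne'
      have hVt : V ≠ ∞ := measure_closedBall_lt_top.ne
      -- Fubini: each point of S is counted by the centres x in its δ-ball, all of which lie in W.
      have key : m S * V ≤ ∫⁻ x in W, m (closedBall x δ) := by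
        have := lintegral_lintegral_closedBall (m.restrict S) (volume.restrict W)
          (g := fun _ => 1) measurable_const δ
        simp only [setLIntegral_one, one_mul] at this
        calc m S * V = ∫⁻ y in S, V ∂m := by rw [setLIntegral_const, mul_comm]
          _ = ∫⁻ y in S, volume.restrict W (closedBall y δ) ∂m := by
              refine setLIntegral_congr_fun hS.measurableSet fun y hy => ?_
              have : closedBall y δ ⊆ W := (closedBall_subset_cthickening hy δ).trans hδW
              rw [Measure.restrict_eq_self _ this, hVx]
          _ = ∫⁻ x in W, m.restrict S (closedBall x δ) := this.symm
          _ ≤ _ := lintegral_mono fun x => Measure.restrict_apply_le _ _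
      calc m S = m S * V / V := (ENNReal.mul_div_cancel_right hV0 hVt).symm
        _ ≤ (∫⁻ x in W, m (closedBall x δ)) / V := by gcongr
        _ = ∫⁻ x in W, m (closedBall x δ) / volume (closedBall x δ) := by
            simp_rw [hVx, div_eq_mul_inv]
            rw [lintegral_mul_const _ (measurable_measure_inter_closedBall m δ)]
        -- Pointwise a ≤ ta² + t⁻¹. The second term costs t⁻¹|W| ≤ t, as W has measure below t².
        _ ≤ ∫⁻ x in W, (t * (m (closedBall x δ) / volume (closedBall x δ)) ^ 2
              + (t : ℝ≥0∞)⁻¹) := by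
            refine lintegral_mono fun x => ?_
            set a := m (closedBall x δ) / volume (closedBall x δ)
            rcases le_total a (t : ℝ≥0∞)⁻¹ with ha | ha
            · exact ha.trans le_add_self
            · refine le_trans ?_ le_self_add
              have h1 : 1 ≤ t * a := by
                rw [← ENNReal.mul_inv_cancel ht0 ENNReal.coe_ne_top]; gcongr
              calc a = 1 * a := (one_mul a).symm
                _ ≤ (t * a) * a := by gcongr
                _ = t * a ^ 2 := by ring
        _ = t * (∫⁻ x in W, (m (closedBall x δ) / volume (closedBall x δ)) ^ 2)
              + (t : ℝ≥0∞)⁻¹ * volume W := by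
            rw [lintegral_add_right _ measurable_const, setLIntegral_const, lintegral_const_mul]
            exact ((measurable_measure_inter_closedBall m _).div
              (measurable_measure_inter_closedBall volume _)).pow_const 2
        _ ≤ t * K + (t : ℝ≥0∞)⁻¹ * (t : ℝ≥0∞) ^ 2 := by
            gcongr
            exact (setLIntegral_le_lintegral _ _).trans (h δ hδ)
        _ = t * (K + 1) := by
            rw [pow_two, ← mul_assoc, ENNReal.inv_mul_cancel ht0 ENNReal.coe_ne_top]; ring
    lift K to ℝ≥0 using hK
    refine le_antisymm (ENNReal.le_of_forall_pos_le_add fun ε hε _ => ?_) zero_le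
    refine (bound (ε / (K + 1)) (by positivity)).trans ?_
    rw [zero_add]
    norm_cast
    rw [div_mul_cancel₀]
    positivity
  refine Measure.AbsolutelyContinuous.mk fun N hN hN0 => ?_
  rw [hN.measure_eq_iSup_isCompact]
  simp only [ENNReal.iSup_eq_zero]
  exact fun S hSN hS => compact_case S hS (measure_mono_null hSN hN0)

end L2

/-! ### Transversality estimate and local L² bound -/

section Transversal

variable {μ : Measure (EuclideanSpace ℝ (Fin 2))} {C₁ C₂ : Cone 2}
  {Ω₁ Ω₂ : Type*} [MeasurableSpace Ω₁] [MeasurableSpace Ω₂]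

/-- Fubini for a pair of representations. -/
theorem lintegral_ν_ν (R₁ : AlbertiRep μ C₁ Ω₁) (R₂ : AlbertiRep μ C₂ Ω₂)
    {F : EuclideanSpace ℝ (Fin 2) → EuclideanSpace ℝ (Fin 2) → ℝ≥0∞}
    (hF : Measurable (Function.uncurry F)) :
    ∫⁻ y, ∫⁻ z, F y z ∂ R₂.ν ∂ R₁.ν = ∫⁻ ω₁, ∫⁻ ω₂, ∫⁻ z, ∫⁻ y, F y z ∂ R₁.curveMeasure ω₁
      ∂ R₂.curveMeasure ω₂ ∂ R₂.P ∂ R₁.P := by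
  rw [R₁.lintegral_ν hF.lintegral_prod_right]
  refine lintegral_congr fun ω₁ => ?_
  rw [lintegral_lintegral_swap hF.aemeasurable, R₂.lintegral_ν hF.lintegral_prod_left]

/-- Two transversal graphs stay close to each other only in a small ball. -/
theorem dist_le_of_transversal {κ : ℝ} (hκ0 : 0 < κ)
    (hκ : ∀ v ∈ C₁.carrier, ∀ w ∈ C₂.carrier, κ * (‖v‖ * ‖w‖) ≤ |cross v w|)
    {γ₁ γ₂ : Set (EuclideanSpace ℝ (Fin 2))} (h₁ : C₁.IsGraph γ₁) (h₂ : C₂.IsGraph γ₂)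
    {y y' z z' : EuclideanSpace ℝ (Fin 2)} (hy : y ∈ γ₁) (hy' : y' ∈ γ₁) (hz : z ∈ γ₂)
    (hz' : z' ∈ γ₂) {s : ℝ} (h : dist y z ≤ s) (h' : dist y' z' ≤ s) :
    dist z' z ≤ (2 / κ + 2) * s := by
  set v := y' - y with hv
  set w := z' - z with hw
  have hvw : ‖v - w‖ ≤ 2 * s := by
    rw [dist_eq_norm] at h h'
    calc ‖v - w‖ = ‖(y' - z') - (y - z)‖ := by rw [hv, hw]; congr 1; abel
      _ ≤ ‖y' - z'‖ + ‖y - z‖ := norm_sub_le _ _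
      _ ≤ 2 * s := by linarith
  -- As v × v = 0, the area spanned by v and w is at most ‖v‖·2s, while transversality bounds it
  -- below by κ‖v‖‖w‖.
  have hc : cross v w = cross v (w - v) := by
    simp only [cross, PiLp.sub_apply]; ring
  have h1 : κ * (‖v‖ * ‖w‖) ≤ ‖v‖ * (2 * s) := by
    refine (hκ v (h₁ _ hy' _ hy) w (h₂ _ hz' _ hz)).trans ?_
    rw [hc]
    refine (abs_cross_le _ _).trans ?_
    gcongr
    rwa [norm_sub_rev]
  have hs : 0 ≤ s := dist_nonneg.trans h
  rw [dist_eq_norm]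
  change ‖w‖ ≤ _
  have h2s : 2 / κ * s + 2 * s = (2 / κ + 2) * s := by ring
  rcases eq_or_ne v 0 with h0 | h0
  · rw [h0, zero_sub, norm_neg] at hvw
    have : 0 ≤ 2 / κ * s := by positivity
    linarith
  · have hv0 := norm_pos_iff.2 h0
    have h3 : κ * ‖w‖ ≤ 2 * s := by
      refine le_of_mul_le_mul_left ?_ hv0
      linarith
    have : ‖w‖ ≤ 2 / κ * s := by
      rw [div_mul_eq_mul_div, le_div_iff₀ hκ0]; linarith
    linarith

/-- The transversality estimate: the product of two independent representations gives little mass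
to a neighbourhood of the diagonal. -/
theorem lintegral_ν_closedBall_le {κ : ℝ} (hκ0 : 0 < κ)
    (hκ : ∀ v ∈ C₁.carrier, ∀ w ∈ C₂.carrier, κ * (‖v‖ * ‖w‖) ≤ |cross v w|)
    (R₁ : AlbertiRep μ C₁ Ω₁) (R₂ : AlbertiRep μ C₂ Ω₂) {U : Set (EuclideanSpace ℝ (Fin 2))}
    (hU : MeasurableSet U) {s : ℝ} (hs : 0 < s) :
    ∫⁻ y in U, R₂.ν (U ∩ closedBall y s) ∂ R₁.ν ≤
      ENNReal.ofReal (2 / C₁.θ * (2 * (2 / κ + 2) / C₂.θ) * s ^ 2) *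
        (R₁.P {ω | R₁.curveMeasure ω U ≠ 0} * R₂.P {ω | R₂.curveMeasure ω U ≠ 0}) := by
  set T : Set (EuclideanSpace ℝ (Fin 2) × EuclideanSpace ℝ (Fin 2)) :=
    {p | p.1 ∈ U ∧ p.2 ∈ U ∧ dist p.1 p.2 ≤ s} with hTdef
  have hcl : IsClosed {p : EuclideanSpace ℝ (Fin 2) × EuclideanSpace ℝ (Fin 2) |
      dist p.1 p.2 ≤ s} := isClosed_le (by fun_prop) (by fun_prop)
  have hT : MeasurableSet T :=
    (measurable_fst hU).inter ((measurable_snd hU).inter hcl.measurableSet)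
  have hθ₁ := C₁.θ_pos
  have hθ₂ := C₂.θ_pos
  set D : ℝ≥0∞ := ENNReal.ofReal (2 * s / C₁.θ)
  set L : ℝ≥0∞ := ENNReal.ofReal (2 / C₁.θ * (2 * (2 / κ + 2) / C₂.θ) * s ^ 2) with hL
  set A₁ := {ω | R₁.curveMeasure ω U ≠ 0}
  set A₂ := {ω | R₂.curveMeasure ω U ≠ 0}
  have hA₁ : MeasurableSet A₁ := (measurableSet_singleton 0).compl.preimage
      ((Measure.measurable_coe hU).comp R₁.measurable_curveMeasure)
  have hA₂ : MeasurableSet A₂ := (measurableSet_singleton 0).compl.preimage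
      ((Measure.measurable_coe hU).comp R₂.measurable_curveMeasure)
  have hslice : ∀ z, MeasurableSet {y | (y, z) ∈ T} := fun z => measurable_prodMk_right hT
  have hinner : ∀ ω₁ z, ∫⁻ y, T.indicator (fun _ => (1 : ℝ≥0∞)) (y, z) ∂ R₁.curveMeasure ω₁ =
      R₁.curveMeasure ω₁ {y | (y, z) ∈ T} := by
    intro ω₁ z
    rw [← lintegral_indicator_one (hslice z)]
    rfl
  have hinnerD : ∀ ω₁ z, R₁.curveMeasure ω₁ {y | (y, z) ∈ T} ≤ D := fun ω₁ z =>
    (measure_mono fun y hy => hy.2.2).trans (R₁.curveMeasure_closedBall_le ω₁ z s)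
  have point : ∀ ω₁ ω₂, ∫⁻ z, ∫⁻ y, T.indicator (fun _ => (1 : ℝ≥0∞)) (y, z)
      ∂ R₁.curveMeasure ω₁ ∂ R₂.curveMeasure ω₂ ≤
      L * (A₁.indicator 1 ω₁ * A₂.indicator 1 ω₂) := by
    intro ω₁ ω₂
    simp_rw [hinner]
    by_cases h1 : ω₁ ∈ A₁
    swap
    · have h1' : R₁.curveMeasure ω₁ U = 0 := by simpa [A₁] using h1
      have : ∀ z, R₁.curveMeasure ω₁ {y | (y, z) ∈ T} = 0 := fun z =>
        measure_mono_null (fun y hy => hy.1) h1'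
      simp [this]
    by_cases h2 : ω₂ ∈ A₂
    swap
    · have h2' : R₂.curveMeasure ω₂ U = 0 := by simpa [A₂] using h2
      have hae : ∀ᵐ z ∂ R₂.curveMeasure ω₂, z ∉ U := by simpa [ae_iff] using h2'
      rw [lintegral_congr_ae (g := fun _ => 0)]
      · simp
      filter_upwards [hae] with z hz
      exact measure_mono_null (fun y hy => (hz hy.2.1).elim) measure_empty
    rw [indicator_of_mem h1, indicator_of_mem h2, Pi.one_apply, Pi.one_apply, one_mul, mul_one]
    have hmem : ∀ᵐ z ∂ R₂.curveMeasure ω₂, z ∈ R₂.γ ω₂ :=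
      ae_restrict_mem (R₂.maximal ω₂).isClosed.measurableSet
    have hhit : ∀ z, R₁.curveMeasure ω₁ {y | (y, z) ∈ T} ≠ 0 → ∃ y ∈ R₁.γ ω₁, dist y z ≤ s := by
      intro z hz
      rw [R₁.curveMeasure_apply] at hz
      obtain ⟨y, hy, hyγ⟩ := nonempty_of_measure_ne_zero hz
      exact ⟨y, hyγ, hy.2.2⟩
    -- One close pair (y₀, z₀) serves as an anchor: every other z on the second graph that is close
    -- to the first lies within (2/κ + 2)s of z₀, and each such z sees length at most D of the first
    -- graph.
    by_cases hex : ∃ z ∈ R₂.γ ω₂, R₁.curveMeasure ω₁ {y | (y, z) ∈ T} ≠ 0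
    · obtain ⟨z₀, hz₀, hne⟩ := hex
      obtain ⟨y₀, hy₀, hyz₀⟩ := hhit z₀ hne
      calc ∫⁻ z, R₁.curveMeasure ω₁ {y | (y, z) ∈ T} ∂ R₂.curveMeasure ω₂
          ≤ ∫⁻ z, (closedBall z₀ ((2 / κ + 2) * s)).indicator (fun _ => D) z
              ∂ R₂.curveMeasure ω₂ := by
            refine lintegral_mono_ae ?_
            filter_upwards [hmem] with z hz
            by_cases h0 : R₁.curveMeasure ω₁ {y | (y, z) ∈ T} = 0
            · rw [h0]; exact zero_le
            · obtain ⟨y, hy, hyz⟩ := hhit z h0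
              have hd := dist_le_of_transversal hκ0 hκ (R₁.maximal ω₁).1 (R₂.maximal ω₂).1 hy₀ hy
                hz₀ hz hyz₀ hyz
              rw [indicator_of_mem (mem_closedBall.2 hd)]
              exact hinnerD ω₁ z
        _ = D * R₂.curveMeasure ω₂ (closedBall z₀ ((2 / κ + 2) * s)) := by
            rw [lintegral_indicator measurableSet_closedBall, setLIntegral_const]
        _ ≤ D * ENNReal.ofReal (2 * ((2 / κ + 2) * s) / C₂.θ) := by
            gcongr; exact R₂.curveMeasure_closedBall_le ω₂ _ _
        _ = L := by
            rw [← ENNReal.ofReal_mul (by positivity), hL]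
            congr 1
            ring
    · push Not at hex
      rw [lintegral_congr_ae (g := fun _ => 0)]
      · simp
      filter_upwards [hmem] with z hz
      exact hex z hz
  have hFm : Measurable (Function.uncurry fun y z => T.indicator (fun _ => (1 : ℝ≥0∞)) (y, z)) :=
    measurable_const.indicator hT
  calc ∫⁻ y in U, R₂.ν (U ∩ closedBall y s) ∂ R₁.ν
      = ∫⁻ y, ∫⁻ z, T.indicator (fun _ => (1 : ℝ≥0∞)) (y, z) ∂ R₂.ν ∂ R₁.ν := by
        rw [← lintegral_indicator hU]
        refine lintegral_congr fun y => ?_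
        by_cases hy : y ∈ U
        · rw [indicator_of_mem hy,
            ← lintegral_indicator_one (hU.inter measurableSet_closedBall)]
          refine lintegral_congr fun z => ?_
          have hiff : z ∈ U ∩ closedBall y s ↔ (y, z) ∈ T := by
            rw [mem_inter_iff, mem_closedBall, dist_comm]
            exact ⟨fun h => ⟨hy, h⟩, fun h => h.2⟩
          by_cases hz : (y, z) ∈ T
          · rw [indicator_of_mem hz, indicator_of_mem (hiff.2 hz), Pi.one_apply]
          · rw [indicator_of_notMem hz, indicator_of_notMem (mt hiff.1 hz)]
        · simp [indicator, hy, T]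
    _ = _ := lintegral_ν_ν R₁ R₂ hFm
    _ ≤ ∫⁻ ω₁, ∫⁻ ω₂, L * (A₁.indicator 1 ω₁ * A₂.indicator 1 ω₂) ∂ R₂.P ∂ R₁.P :=
        lintegral_mono fun ω₁ => lintegral_mono fun ω₂ => point ω₁ ω₂
    _ = L * (R₁.P A₁ * R₂.P A₂) := by
        have hm₂ : Measurable (A₂.indicator (1 : Ω₂ → ℝ≥0∞)) := measurable_one.indicator hA₂
        have hm₁ : Measurable (A₁.indicator (1 : Ω₁ → ℝ≥0∞)) := measurable_one.indicator hA₁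
        have : ∀ ω₁, ∫⁻ ω₂, L * (A₁.indicator 1 ω₁ * A₂.indicator 1 ω₂) ∂ R₂.P =
            L * (A₁.indicator 1 ω₁ * R₂.P A₂) := by
          intro ω₁
          rw [lintegral_const_mul _ (hm₂.const_mul _), lintegral_const_mul _ hm₂,
            lintegral_indicator_one hA₂]
        simp_rw [this]
        rw [lintegral_const_mul _ (hm₁.mul_const _), lintegral_mul_const _ hm₁,
          lintegral_indicator_one hA₁]

/-- The local `L²` estimate for a measure with two independent bounded above representations. -/
theorem exists_lintegral_rnDeriv_sq_le [IsLocallyFiniteMeasure μ] (hC : C₁.Independent C₂)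
    (R₁ : AlbertiRep μ C₁ Ω₁) (R₂ : AlbertiRep μ C₂ Ω₂) :
    ∃ K : ℝ≥0, ∀ (U : Set (EuclideanSpace ℝ (Fin 2))) (M : ℝ≥0), MeasurableSet U →
      μ.restrict U ≤ (M : ℝ≥0∞) • R₁.ν.restrict U → μ.restrict U ≤ (M : ℝ≥0∞) • R₂.ν.restrict U →
      μ.restrict U ≪ volume ∧ ∫⁻ x in U, μ.rnDeriv volume x ^ 2 ≤
        K * M ^ 2 * (R₁.P {ω | R₁.curveMeasure ω U ≠ 0} *
          R₂.P {ω | R₂.curveMeasure ω U ≠ 0}) := by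
  obtain ⟨κ, hκ0, -, hκ⟩ := hC.exists_cross
  have hθ₁ := C₁.θ_pos
  have hθ₂ := C₂.θ_pos
  set v := volume (ball (0 : EuclideanSpace ℝ (Fin 2)) 1) with hv
  have hv0 : v ≠ 0 := (measure_ball_pos _ _ one_pos).ne'
  have hvt : v ≠ ∞ := measure_ball_lt_top.ne
  set a : ℝ := 2 / C₁.θ * (2 * (2 / κ + 2) / C₂.θ) with ha
  have ha0 : 0 ≤ a := by positivity
  have hKfin : ENNReal.ofReal (4 * a) / v ≠ ∞ := (ENNReal.div_lt_top ENNReal.ofReal_ne_top hv0).ne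
  -- The constant depends only on the cones, not on U or M, so the bound can be used on balls of
  -- every scale.
  refine ⟨(ENNReal.ofReal (4 * a) / v).toNNReal, fun U M hU h₁ h₂ => ?_⟩
  rw [ENNReal.coe_toNNReal hKfin]
  have := R₁.finite_P
  have := R₂.finite_P
  set p := R₁.P {ω | R₁.curveMeasure ω U ≠ 0} * R₂.P {ω | R₂.curveMeasure ω U ≠ 0} with hp
  have hpt : p ≠ ∞ := ENNReal.mul_ne_top (measure_ne_top _ _) (measure_ne_top _ _)
  set m := μ.restrict U with hm
  have avg : ∀ δ : ℝ, 0 < δ → ∫⁻ x, (m (closedBall x δ) / volume (closedBall x δ)) ^ 2 ≤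
      ENNReal.ofReal (4 * a) / v * M ^ 2 * p := by
    intro δ hδ
    set V := ENNReal.ofReal (δ ^ 2) * v with hV
    have hVx : ∀ x : EuclideanSpace ℝ (Fin 2), volume (closedBall x δ) = V := fun x => by
      rw [Measure.addHaar_closedBall _ _ hδ.le, finrank_euclideanSpace_fin]
    have hδ2 : ENNReal.ofReal (δ ^ 2) ≠ 0 := by
      rw [ENNReal.ofReal_ne_zero_iff]; positivity
    have hV0 : V ≠ 0 := mul_ne_zero hδ2 hv0
    have hVt : V ≠ ∞ := ENNReal.mul_ne_top ENNReal.ofReal_ne_top hvt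
    set g : EuclideanSpace ℝ (Fin 2) → ℝ≥0∞ := fun y => R₂.ν.restrict U (closedBall y (2 * δ))
    have hg : Measurable g := measurable_measure_inter_closedBall _ _
    -- One upper bound is used for each factor. The ν₂-mass is then put inside the ν₁-integral by
    -- enlarging B(x,δ) to B(y,2δ), which contains it whenever y ∈ B(x,δ).
    have hsq : ∀ x, m (closedBall x δ) ^ 2 ≤
        M ^ 2 * ∫⁻ y in closedBall x δ, g y ∂ (R₁.ν.restrict U) := by
      intro x
      have e₁ : m (closedBall x δ) ≤ M * R₁.ν.restrict U (closedBall x δ) := h₁ _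
      have e₂ : m (closedBall x δ) ≤ M * R₂.ν.restrict U (closedBall x δ) := h₂ _
      calc m (closedBall x δ) ^ 2 = m (closedBall x δ) * m (closedBall x δ) := pow_two _
        _ ≤ (M * R₁.ν.restrict U (closedBall x δ)) * (M * R₂.ν.restrict U (closedBall x δ)) := by
            gcongr
        _ = M ^ 2 * (R₂.ν.restrict U (closedBall x δ) * R₁.ν.restrict U (closedBall x δ)) := by
            ring
        _ = M ^ 2 * ∫⁻ y in closedBall x δ, R₂.ν.restrict U (closedBall x δ)
              ∂ (R₁.ν.restrict U) := by rw [setLIntegral_const]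
        _ ≤ _ := by
            gcongr 1
            refine setLIntegral_mono hg fun y hy => measure_mono ?_
            refine closedBall_subset_closedBall' ?_
            have : dist x y ≤ δ := by rw [dist_comm]; exact hy
            linarith
    calc ∫⁻ x, (m (closedBall x δ) / volume (closedBall x δ)) ^ 2
        = ∫⁻ x, m (closedBall x δ) ^ 2 * (V⁻¹) ^ 2 := by
          simp_rw [hVx, div_eq_mul_inv, mul_pow]
      _ = (∫⁻ x, m (closedBall x δ) ^ 2) * (V⁻¹) ^ 2 :=
          lintegral_mul_const _ ((measurable_measure_inter_closedBall m δ).pow_const 2)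
      _ ≤ (∫⁻ x, M ^ 2 * ∫⁻ y in closedBall x δ, g y ∂ (R₁.ν.restrict U)) * (V⁻¹) ^ 2 := by
          gcongr with x; exact hsq x
      _ = (M ^ 2 * ∫⁻ x, ∫⁻ y in closedBall x δ, g y ∂ (R₁.ν.restrict U)) * (V⁻¹) ^ 2 := by
          rw [lintegral_const_mul' _ _ (by simp)]
      _ = (M ^ 2 * ((∫⁻ y in U, g y ∂ R₁.ν) * V)) * (V⁻¹) ^ 2 := by
          rw [lintegral_lintegral_closedBall _ _ hg]
          simp_rw [hVx]
          rw [lintegral_mul_const _ hg]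
      _ = M ^ 2 * (∫⁻ y in U, g y ∂ R₁.ν) * (V * V⁻¹) * V⁻¹ := by ring
      _ = M ^ 2 * (∫⁻ y in U, R₂.ν (U ∩ closedBall y (2 * δ)) ∂ R₁.ν) * V⁻¹ := by
          rw [ENNReal.mul_inv_cancel hV0 hVt, mul_one]
          simp_rw [g, Measure.restrict_apply measurableSet_closedBall, inter_comm]
      -- Transversality at scale 2δ gives δ², which cancels against the area V of the ball: the
      -- bound is independent of δ.
      _ ≤ M ^ 2 * (ENNReal.ofReal (a * (2 * δ) ^ 2) * p) * V⁻¹ := by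
          gcongr
          exact lintegral_ν_closedBall_le hκ0 hκ R₁ R₂ hU (by positivity)
      _ = ENNReal.ofReal (4 * a) / v * M ^ 2 * p := by
          rw [hV, ENNReal.mul_inv (Or.inl hδ2) (Or.inr hv0), div_eq_mul_inv,
            show a * (2 * δ) ^ 2 = (4 * a) * δ ^ 2 by ring, ENNReal.ofReal_mul (by positivity)]
          calc _ = ENNReal.ofReal (4 * a) * v⁻¹ * M ^ 2 * p *
                (ENNReal.ofReal (δ ^ 2) * (ENNReal.ofReal (δ ^ 2))⁻¹) := by ring
            _ = _ := by rw [ENNReal.mul_inv_cancel hδ2 ENNReal.ofReal_ne_top, mul_one]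
  refine ⟨absolutelyContinuous_of_average m ?_ avg, ?_⟩
  · exact ENNReal.mul_ne_top (ENNReal.mul_ne_top hKfin (by simp)) hpt
  · refine le_trans (le_of_eq ?_) (lintegral_rnDeriv_sq_le_of_average m avg)
    rw [← lintegral_indicator hU]
    refine lintegral_congr_ae ?_
    filter_upwards [Measure.rnDeriv_restrict μ volume hU] with x hx
    rw [hx]
    by_cases hxU : x ∈ U <;> simp [hxU]

end Transversal

/-! ### Gehring's lemma -/

section Gehring

/-- One step of the decay of the truncated square integrals. -/
theorem setLIntegral_sq_decay {α : Type*} [MeasurableSpace α] {m : Measure α} {f : α → ℝ≥0∞}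
    (hf : Measurable f) (hfin : ∫⁻ x, f x ^ 2 ∂m ≠ ∞) {C : ℝ≥0} (hC : 1 ≤ C) {l : ℝ≥0}
    (h : ∫⁻ x in {x | ((2 * l : ℝ≥0) : ℝ≥0∞) < f x}, f x ^ 2 ∂m ≤
      C * (2 * l : ℝ≥0) * ∫⁻ x in {x | (l : ℝ≥0∞) < f x}, f x ∂m) :
    ∫⁻ x in {x | ((4 * C * l : ℝ≥0) : ℝ≥0∞) < f x}, f x ^ 2 ∂m ≤
      (4 * C / (1 + 4 * C) : ℝ≥0) * ∫⁻ x in {x | (l : ℝ≥0∞) < f x}, f x ^ 2 ∂m := by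
  set H := {x | ((4 * C * l : ℝ≥0) : ℝ≥0∞) < f x}
  set G := {x | (l : ℝ≥0∞) < f x}
  have hH : MeasurableSet H := measurableSet_lt measurable_const hf
  have hG : MeasurableSet G := measurableSet_lt measurable_const hf
  have hl4 : (l : ℝ≥0∞) ≤ (4 * C * l : ℝ≥0) := by
    rw [ENNReal.coe_le_coe]
    calc l = 1 * 1 * l := by ring
      _ ≤ 4 * C * l := by gcongr; norm_num
  have hl2 : ((2 * l : ℝ≥0) : ℝ≥0∞) ≤ (4 * C * l : ℝ≥0) := by
    rw [ENNReal.coe_le_coe]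
    calc 2 * l = 2 * 1 * l := by ring
      _ ≤ 4 * C * l := by gcongr; norm_num
  have hHG : H ⊆ G := fun x hx => hl4.trans_lt hx
  set b := ∫⁻ x in H, f x ^ 2 ∂m with hb
  set D := ∫⁻ x in G \ H, f x ^ 2 ∂m with hD
  have hsplit : ∫⁻ x in G, f x ^ 2 ∂m = D + b := by
    rw [← lintegral_inter_add_sdiff (fun x => f x ^ 2) G hH, inter_eq_right.2 hHG, add_comm]
  have hbt : b ≠ ∞ := ((setLIntegral_le_lintegral _ _).trans_lt hfin.lt_top).ne
  have hDt : D ≠ ∞ := ((setLIntegral_le_lintegral _ _).trans_lt hfin.lt_top).ne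
  have h1 : (C : ℝ≥0∞) * (2 * l : ℝ≥0) * ∫⁻ x in G \ H, f x ∂m ≤ 2 * C * D := by
    rw [hD, ← lintegral_const_mul _ hf, ← lintegral_const_mul _ (hf.pow_const 2)]
    refine setLIntegral_mono' (hG.diff hH) fun x hx => ?_
    have hx1 : (l : ℝ≥0∞) ≤ f x := le_of_lt hx.1
    calc (C : ℝ≥0∞) * (2 * l : ℝ≥0) * f x = 2 * C * (l * f x) := by push_cast; ring
      _ ≤ 2 * C * (f x * f x) := by gcongr
      _ = _ := by ring
  -- Above height 4Cl, the linear term is at most half of f², so it can be absorbed; finiteness of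
  -- the square integral makes this legitimate. Below that height, the term is at most 2Cf².
  -- Together b ≤ 4CD, which gives the ratio 4C/(1 + 4C).
  have h2 : 2 * ((C : ℝ≥0∞) * (2 * l : ℝ≥0) * ∫⁻ x in H, f x ∂m) ≤ b := by
    rw [hb, ← lintegral_const_mul _ hf, ← lintegral_const_mul _ (hf.const_mul _)]
    refine setLIntegral_mono' hH fun x hx => ?_
    have hx1 : ((4 * C * l : ℝ≥0) : ℝ≥0∞) ≤ f x := le_of_lt hx
    calc 2 * ((C : ℝ≥0∞) * (2 * l : ℝ≥0) * f x) = (4 * C * l : ℝ≥0) * f x := by push_cast; ring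
      _ ≤ f x * f x := by gcongr
      _ = _ := by ring
  have h3 : b ≤ (C : ℝ≥0∞) * (2 * l : ℝ≥0) * ∫⁻ x in G, f x ∂m :=
    (lintegral_mono_set fun x hx => hl2.trans_lt hx).trans h
  rw [← lintegral_inter_add_sdiff f G hH, inter_eq_right.2 hHG, mul_add] at h3
  have h4 : 2 * b ≤ b + 4 * C * D := by
    calc 2 * b ≤ 2 * _ := by gcongr
      _ = _ := mul_add _ _ _
      _ ≤ b + 2 * (2 * C * D) := by gcongr
      _ = _ := by ring
  rw [hsplit]
  clear_value b D
  lift b to ℝ≥0 using hbt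
  lift D to ℝ≥0 using hDt
  norm_cast at h4 ⊢
  rw [div_mul_eq_mul_div, le_div_iff₀ (by positivity)]
  have h5 : (2 * b : ℝ) ≤ b + 4 * C * D := by exact_mod_cast h4
  have : (b : ℝ) * (1 + 4 * C) ≤ 4 * C * (D + b) := by linarith
  exact_mod_cast this

/-- Reverse Hölder inequalities on level sets improve integrability. -/
theorem exists_lintegral_rpow_lt_top_of_level {α : Type*} [MeasurableSpace α] {m : Measure α}
    {f : α → ℝ≥0∞} (hf : Measurable f) (hfin : ∫⁻ x, f x ^ 2 ∂m ≠ ∞) {C l₀ : ℝ≥0} (hC : 1 ≤ C)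
    (hl₀ : 0 < l₀)
    (h : ∀ l : ℝ≥0, l₀ ≤ l → ∫⁻ x in {x | ((2 * l : ℝ≥0) : ℝ≥0∞) < f x}, f x ^ 2 ∂m ≤
      C * (2 * l : ℝ≥0) * ∫⁻ x in {x | (l : ℝ≥0∞) < f x}, f x ∂m) :
    ∃ ε : ℝ≥0, 0 < ε ∧ ∫⁻ x, f x ^ (2 + ε : ℝ) ∂m < ∞ := by
  set T : ℝ≥0 := 4 * C with hT
  set η : ℝ≥0 := 4 * C / (1 + 4 * C) with hη
  have hT1 : 1 < T := by
    calc (1 : ℝ≥0) < 4 * 1 := by norm_num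
      _ ≤ 4 * C := by gcongr
  have hη1 : η < 1 := by
    rw [hη, div_lt_one (by positivity)]
    exact lt_one_add _
  -- Heights grow by T while square integrals shrink by η; a small ε keeps T^ε η below 1, so the
  -- layer sum is a convergent geometric series.
  obtain ⟨ε, hε, hεη⟩ : ∃ ε : ℝ≥0, 0 < ε ∧ T ^ (ε : ℝ) * η < 1 := by
    have hcont : Filter.Tendsto (fun e : ℝ≥0 => T ^ (e : ℝ) * η) (nhdsWithin 0 (Ioi 0))
        (nhds (T ^ ((0 : ℝ≥0) : ℝ) * η)) := by
      have : Continuous fun e : ℝ≥0 => T ^ (e : ℝ) * η := by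
        refine Continuous.mul ?_ continuous_const
        refine continuous_iff_continuousAt.2 fun e => ?_
        exact (NNReal.continuousAt_rpow (Or.inl (one_pos.trans hT1).ne')).comp₂
          continuousAt_const NNReal.continuous_coe.continuousAt
      exact this.continuousAt.tendsto.mono_left nhdsWithin_le_nhds
    rw [NNReal.coe_zero, NNReal.rpow_zero, one_mul] at hcont
    have h1 := hcont.eventually_lt_const hη1
    obtain ⟨e, he, he0⟩ := (h1.and self_mem_nhdsWithin).exists
    exact ⟨e, he0, he⟩
  refine ⟨ε, hε, ?_⟩
  set S := ∫⁻ x, f x ^ 2 ∂m with hS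
  have decay : ∀ k : ℕ, ∫⁻ x in {x | ((T ^ k * l₀ : ℝ≥0) : ℝ≥0∞) < f x}, f x ^ 2 ∂m ≤
      (η ^ k : ℝ≥0) * S := by
    intro k
    induction k with
    | zero => simpa using setLIntegral_le_lintegral _ _
    | succ k ih =>
      have hk : l₀ ≤ T ^ k * l₀ := le_mul_of_one_le_left' (one_le_pow₀ hT1.le)
      have := setLIntegral_sq_decay hf hfin hC (h _ hk)
      rw [← hT, ← hη, ← mul_assoc, ← pow_succ'] at this
      refine this.trans ?_
      calc (η : ℝ≥0∞) * _ ≤ η * ((η ^ k : ℝ≥0) * S) := by gcongr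
        _ = _ := by push_cast; ring
  have hae : ∀ᵐ x ∂m, f x < ∞ := by
    filter_upwards [ae_lt_top (hf.pow_const 2) hfin] with x hx
    by_contra hc
    rw [not_lt_top_iff] at hc
    simp [hc] at hx
  -- Layers in powers of T: for T^k l₀ < f ≤ T^(k+1) l₀, the k-th term alone dominates.
  have hpoint : ∀ᵐ x ∂m, f x ^ (2 + ε : ℝ) ≤ (l₀ : ℝ≥0∞) ^ (ε : ℝ) * f x ^ 2 +
      ∑' k : ℕ, ((T ^ (k + 1) * l₀ : ℝ≥0) : ℝ≥0∞) ^ (ε : ℝ) *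
        {x | ((T ^ k * l₀ : ℝ≥0) : ℝ≥0∞) < f x}.indicator (fun x => f x ^ 2) x := by
    filter_upwards [hae] with x hx
    have hpow : f x ^ (2 + ε : ℝ) = f x ^ (ε : ℝ) * f x ^ 2 := by
      rw [add_comm, ENNReal.rpow_add_of_nonneg _ _ (by positivity) (by norm_num),
        ENNReal.rpow_ofNat]
    rw [hpow]
    by_cases hxl : f x ≤ l₀
    · exact le_trans (by gcongr) le_self_add
    push Not at hxl
    have hex : ∃ n : ℕ, f x ≤ (T ^ n * l₀ : ℝ≥0) := by
      lift f x to ℝ≥0 using hx.ne with y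
      obtain ⟨n, hn⟩ := pow_unbounded_of_one_lt (y / l₀) hT1
      refine ⟨n, ENNReal.coe_le_coe.2 ?_⟩
      rw [div_lt_iff₀ hl₀] at hn
      exact hn.le
    classical
    have hspec := Nat.find_spec hex
    have hn0 : Nat.find hex ≠ 0 := by
      intro h0
      rw [h0, pow_zero, one_mul] at hspec
      exact absurd hspec (not_le.2 hxl)
    obtain ⟨k, hk⟩ := Nat.exists_eq_succ_of_ne_zero hn0
    have hmin : ¬ f x ≤ (T ^ k * l₀ : ℝ≥0) := Nat.find_min hex (by omega)
    push Not at hmin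
    rw [hk] at hspec
    refine le_trans ?_ le_add_self
    refine le_trans ?_ (ENNReal.le_tsum k)
    rw [indicator_of_mem (show x ∈ {x | ((T ^ k * l₀ : ℝ≥0) : ℝ≥0∞) < f x} from hmin)]
    gcongr
  have hms : ∀ k : ℕ, MeasurableSet {x | ((T ^ k * l₀ : ℝ≥0) : ℝ≥0∞) < f x} := fun k =>
    measurableSet_lt measurable_const hf
  have hmi : ∀ k : ℕ, Measurable
      ({x | ((T ^ k * l₀ : ℝ≥0) : ℝ≥0∞) < f x}.indicator (fun x => f x ^ 2)) := fun k =>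
    (hf.pow_const 2).indicator (hms k)
  have hrpow : ∀ a : ℝ≥0, (a : ℝ≥0∞) ^ (ε : ℝ) = (a ^ (ε : ℝ) : ℝ≥0) := fun a =>
    (ENNReal.coe_rpow_of_nonneg a ε.2).symm
  calc ∫⁻ x, f x ^ (2 + ε : ℝ) ∂m ≤ _ := lintegral_mono_ae hpoint
    _ = (l₀ : ℝ≥0∞) ^ (ε : ℝ) * S + ∑' k : ℕ, ((T ^ (k + 1) * l₀ : ℝ≥0) : ℝ≥0∞) ^ (ε : ℝ) *
          ∫⁻ x in {x | ((T ^ k * l₀ : ℝ≥0) : ℝ≥0∞) < f x}, f x ^ 2 ∂m := by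
        rw [lintegral_add_left ((hf.pow_const 2).const_mul _),
          lintegral_const_mul _ (hf.pow_const 2),
          lintegral_tsum fun k => ((hmi k).const_mul _).aemeasurable]
        congr 2
        ext k
        rw [lintegral_const_mul _ (hmi k), lintegral_indicator (hms k)]
    _ ≤ (l₀ : ℝ≥0∞) ^ (ε : ℝ) * S + ∑' k : ℕ, (((T * l₀) ^ (ε : ℝ) : ℝ≥0) * S) *
          ((T ^ (ε : ℝ) * η : ℝ≥0) : ℝ≥0∞) ^ k := by
        refine add_le_add le_rfl (ENNReal.tsum_le_tsum fun k => ?_)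
        calc _ ≤ ((T ^ (k + 1) * l₀ : ℝ≥0) : ℝ≥0∞) ^ (ε : ℝ) * ((η ^ k : ℝ≥0) * S) := by
              gcongr; exact decay k
          _ = _ := by
              have : (T ^ (k + 1) * l₀) ^ (ε : ℝ) * η ^ k =
                  (T * l₀) ^ (ε : ℝ) * (T ^ (ε : ℝ) * η) ^ k := by
                have hcomm : (T ^ k) ^ (ε : ℝ) = (T ^ (ε : ℝ)) ^ k := by
                  rw [← NNReal.rpow_natCast T k, ← NNReal.rpow_mul, mul_comm, NNReal.rpow_mul,
                    NNReal.rpow_natCast]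
                rw [pow_succ, mul_assoc, NNReal.mul_rpow, hcomm, mul_pow]
                ring
              rw [hrpow, ← mul_assoc, ← ENNReal.coe_mul, this]
              push_cast
              ring
    _ < ∞ := by
        rw [ENNReal.tsum_mul_left, ENNReal.tsum_geometric, hrpow]
        have hlt : ((T ^ (ε : ℝ) * η : ℝ≥0) : ℝ≥0∞) < 1 := by exact_mod_cast hεη
        refine ENNReal.add_lt_top.2 ⟨ENNReal.mul_lt_top ENNReal.coe_lt_top hfin.lt_top,
          ENNReal.mul_lt_top (ENNReal.mul_lt_top ENNReal.coe_lt_top hfin.lt_top) ?_⟩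
        rw [ENNReal.inv_lt_top]
        exact tsub_pos_of_lt hlt

/-- On a ball where the average of `m` exceeds `l`, at least half of the mass lies where the
density exceeds `l / 2`. -/
theorem measure_le_two_mul_of_average_gt {α : Type*} [MeasurableSpace α] {m n : Measure α}
    [IsFiniteMeasure m] [SigmaFinite n] (hmn : m ≪ n) {D : Set α}
    {l : ℝ≥0} (h : ((2 * l : ℝ≥0) : ℝ≥0∞) * n D ≤ m D) :
    m D ≤ 2 * ∫⁻ x in D, {x | (l : ℝ≥0∞) < m.rnDeriv n x}.indicator (m.rnDeriv n) x ∂n := by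
  set f := m.rnDeriv n
  have hf : Measurable f := Measure.measurable_rnDeriv _ _
  set G := {x | (l : ℝ≥0∞) < f x}
  have hG : MeasurableSet G := measurableSet_lt measurable_const hf
  have h1 : m D = ∫⁻ x in D, f x ∂n := (Measure.setLIntegral_rnDeriv hmn D).symm
  have h2 : m D ≤ (∫⁻ x in D, G.indicator f x ∂n) + l * n D := by
    rw [h1, ← setLIntegral_const, ← lintegral_add_left (hf.indicator hG)]
    refine lintegral_mono fun x => ?_
    by_cases hx : x ∈ G
    · rw [indicator_of_mem hx]; exact le_self_add
    · rw [indicator_of_notMem hx, zero_add]; exact not_lt.1 hx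
  have h3 : 2 * m D ≤ 2 * (∫⁻ x in D, G.indicator f x ∂n) + m D := by
    calc 2 * m D ≤ 2 * ((∫⁻ x in D, G.indicator f x ∂n) + l * n D) := by gcongr
      _ = 2 * (∫⁻ x in D, G.indicator f x ∂n) + (2 * l : ℝ≥0) * n D := by push_cast; ring
      _ ≤ _ := by gcongr
  rw [two_mul] at h3
  exact (ENNReal.add_le_add_iff_right (measure_ne_top m D)).1 h3

/-- Gehring's lemma for measures in the plane. -/
theorem exists_lintegral_rnDeriv_rpow_lt_top (m : Measure (EuclideanSpace ℝ (Fin 2)))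
    [IsFiniteMeasure m] (hac : m ≪ volume) (hfin : ∫⁻ x, m.rnDeriv volume x ^ 2 ≠ ∞)
    {X : Set (EuclideanSpace ℝ (Fin 2))} (hX : ∀ᵐ x, m.rnDeriv volume x ≠ 0 → x ∈ X)
    {C : ℝ≥0} {s₀ : ℝ} (hs₀ : 0 < s₀)
    (hRH : ∀ x ∈ X, ∀ s : ℝ, 0 < s → s ≤ s₀ →
      ENNReal.ofReal (s ^ 2) * ∫⁻ y in closedBall x (5 * s), m.rnDeriv volume y ^ 2 ≤
        C * m (closedBall x (6 * s)) ^ 2) :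
    ∃ ε : ℝ≥0, 0 < ε ∧ ∫⁻ x, m.rnDeriv volume x ^ (2 + ε : ℝ) < ∞ := by
  set f := m.rnDeriv volume with hfdef
  have hf : Measurable f := Measure.measurable_rnDeriv _ _
  set v : ℝ≥0 := (volume (ball (0 : EuclideanSpace ℝ (Fin 2)) 1)).toNNReal with hv
  have hvol : ∀ (x : EuclideanSpace ℝ (Fin 2)) {s : ℝ}, 0 ≤ s →
      volume (closedBall x s) = ENNReal.ofReal (s ^ 2) * v := fun x s hs => by
    rw [Measure.addHaar_closedBall _ _ hs, finrank_euclideanSpace_fin, hv,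
      ENNReal.coe_toNNReal measure_ball_lt_top.ne]
  have hlt : ∀ x : EuclideanSpace ℝ (Fin 2), volume (closedBall x s₀) ≠ ∞ := fun x =>
    measure_closedBall_lt_top.ne
  -- Above this level no ball of radius s₀ has average exceeding l, so the stopping procedure cannot
  -- halt at the first radius.
  set l₀ : ℝ≥0 := (m univ / (ENNReal.ofReal (s₀ ^ 2) * v)).toNNReal + 1 with hl₀
  have hden0 : ENNReal.ofReal (s₀ ^ 2) * v ≠ 0 := by
    rw [← hvol 0 hs₀.le]; exact (measure_closedBall_pos _ _ hs₀).ne'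
  have hdent : ENNReal.ofReal (s₀ ^ 2) * v ≠ ∞ := by
    rw [← hvol 0 hs₀.le]; exact hlt 0
  have hbig : ∀ (x : EuclideanSpace ℝ (Fin 2)) (l : ℝ≥0), l₀ ≤ l →
      m (closedBall x s₀) ≤ l * volume (closedBall x s₀) := by
    intro x l hl
    rw [hvol x hs₀.le, ← ENNReal.div_le_iff hden0 hdent]
    calc m (closedBall x s₀) / _ ≤ m univ / _ := by gcongr; exact subset_univ _
      _ = ((m univ / (ENNReal.ofReal (s₀ ^ 2) * v)).toNNReal : ℝ≥0∞) :=
          (ENNReal.coe_toNNReal (ENNReal.div_lt_top (measure_ne_top _ _) hden0).ne).symm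
      _ ≤ l₀ := ENNReal.coe_le_coe.2 le_self_add
      _ ≤ l := ENNReal.coe_le_coe.2 hl
  set A : ℝ≥0 := 2 * (C * 36 ^ 2 * v) + 1 with hA
  refine exists_lintegral_rpow_lt_top_of_level hf hfin (C := A) (l₀ := l₀) le_add_self
    (by positivity) fun l' hl' => ?_
  set l : ℝ≥0 := 2 * l' with hl
  have hl₀l : l₀ ≤ l := hl'.trans (by rw [hl, two_mul]; exact le_self_add)
  set G : Set (EuclideanSpace ℝ (Fin 2)) := {x | (l : ℝ≥0∞) < f x}
  -- the points at which a stopping radius exists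
  set Y : Set (EuclideanSpace ℝ (Fin 2)) := {x | x ∈ X ∧ ∃ s : ℝ, 0 < s ∧ s ≤ s₀ ∧
    (l : ℝ≥0∞) * volume (closedBall x s) ≤ m (closedBall x s) ∧
    m (closedBall x (6 * s)) ≤ l * volume (closedBall x (6 * s))} with hY
  have hGY : ∀ᵐ x, x ∈ G → x ∈ Y := by
    filter_upwards [hX, Besicovitch.ae_tendsto_rnDeriv m volume] with x hxX hx hxG
    have hxl : (l : ℝ≥0∞) < f x := hxG
    refine ⟨hxX (zero_le.trans_lt hxl).ne', ?_⟩
    -- Stop at the first radius with average above l. The ratio 6 makes the preceding radius exactly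
    -- 6s, where the average is still at most l.
    set u : ℕ → ℝ := fun k => s₀ * (1 / 6) ^ k with hu
    have hu0 : ∀ k, 0 < u k := fun k => by positivity
    have hut : Filter.Tendsto u Filter.atTop (nhdsWithin 0 (Ioi 0)) := by
      refine tendsto_nhdsWithin_iff.2 ⟨?_, Filter.Eventually.of_forall hu0⟩
      simpa [hu] using (tendsto_pow_atTop_nhds_zero_of_lt_one (r := (1 / 6 : ℝ)) (by norm_num)
        (by norm_num)).const_mul s₀
    have hex : ∃ k : ℕ, (l : ℝ≥0∞) * volume (closedBall x (u k)) < m (closedBall x (u k)) := by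
      obtain ⟨k, hk⟩ := ((hx.comp hut).eventually_const_lt hxl).exists
      refine ⟨k, ?_⟩
      rwa [Function.comp_apply, ENNReal.lt_div_iff_mul_lt
        (Or.inl (measure_closedBall_pos _ _ (hu0 k)).ne')
        (Or.inl measure_closedBall_lt_top.ne)] at hk
    classical
    have hspec := Nat.find_spec hex
    have hn0 : Nat.find hex ≠ 0 := by
      intro h0
      rw [h0] at hspec
      simp only [hu, pow_zero, mul_one] at hspec
      exact absurd hspec (not_lt.2 (hbig x l hl₀l))
    obtain ⟨k, hk⟩ := Nat.exists_eq_succ_of_ne_zero hn0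
    have hmin := Nat.find_min hex (m := k) (by omega)
    rw [hk] at hspec
    have h6 : 6 * u (k + 1) = u k := by simp only [hu, pow_succ]; ring
    refine ⟨u (k + 1), hu0 _, ?_, hspec.le, ?_⟩
    · calc s₀ * (1 / 6) ^ (k + 1) ≤ s₀ * 1 := by
            gcongr; exact pow_le_one₀ (by norm_num) (by norm_num)
        _ = s₀ := mul_one _
    · rw [h6]; exact not_lt.1 hmin
  have hYX : ∀ x ∈ Y, x ∈ X := fun x hx => hx.1
  have hYr : ∀ x : EuclideanSpace ℝ (Fin 2), ∃ s : ℝ, x ∈ Y → 0 < s ∧ s ≤ s₀ ∧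
      (l : ℝ≥0∞) * volume (closedBall x s) ≤ m (closedBall x s) ∧
      m (closedBall x (6 * s)) ≤ l * volume (closedBall x (6 * s)) := by
    intro x
    by_cases hx : x ∈ Y
    · obtain ⟨s, hs⟩ := hx.2
      exact ⟨s, fun _ => hs⟩
    · exact ⟨0, fun h => absurd h hx⟩
  choose r hr using hYr
  -- The fivefold enlargements cover G up to a null set; the reverse Hölder inequality with radii 5s
  -- and 6s is fitted to this covering and to the stopping ratio.
  obtain ⟨t, htY, htd, htc⟩ := Vitali.exists_disjoint_subfamily_covering_enlargement_closedBall Y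
    (fun x => x) r s₀ (fun x hx => (hr x hx).2.1) 5 (by norm_num)
  have htcount : t.Countable := htd.countable_of_nonempty_interior fun x hx =>
    (nonempty_ball.2 (hr x (htY hx)).1).mono ball_subset_interior_closedBall
  have := htcount.to_subtype
  set h : EuclideanSpace ℝ (Fin 2) → ℝ≥0∞ := {x | (l' : ℝ≥0∞) < f x}.indicator f with hh
  have hstep : ∀ x ∈ t, ∫⁻ y in closedBall x (5 * r x), f y ^ 2 ≤
      A * l * ∫⁻ y in closedBall x (r x), h y := by
    intro x hx
    obtain ⟨hr0, hrs, hlow, hup⟩ := hr x (htY hx)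
    have e1 := hRH x (hYX x (htY hx)) (r x) hr0 hrs
    have e2 := measure_le_two_mul_of_average_gt hac (l := l') hlow
    set q := ENNReal.ofReal (r x ^ 2)
    have hq0 : q ≠ 0 := by rw [ENNReal.ofReal_ne_zero_iff]; positivity
    have hqt : q ≠ ∞ := ENNReal.ofReal_ne_top
    have hv6 : volume (closedBall x (6 * r x)) = 36 * q * v := by
      rw [hvol x (by positivity), show (6 * r x) ^ 2 = 36 * r x ^ 2 by ring,
        ENNReal.ofReal_mul (by norm_num)]
      norm_num
      rfl
    rw [hv6] at hup
    rw [hvol x hr0.le] at hlow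
    refine (ENNReal.mul_le_mul_iff_right hq0 hqt).1 ?_
    -- One of the two factors l·|B| is kept as l; the other is traded, by the lower stopping bound,
    -- for the mass of the small ball, at least half of which lies where f > l'.
    calc q * ∫⁻ y in closedBall x (5 * r x), f y ^ 2
        ≤ C * m (closedBall x (6 * r x)) ^ 2 := e1
      _ ≤ C * (l * (36 * q * v)) ^ 2 := by gcongr
      _ = q * (C * 36 ^ 2 * v * l * (l * (q * v))) := by ring
      _ ≤ q * (C * 36 ^ 2 * v * l * (2 * ∫⁻ y in closedBall x (r x), h y)) := by
          gcongr q * (_ * ?_); exact hlow.trans e2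
      _ = q * (((2 * (C * 36 ^ 2 * v) : ℝ≥0) : ℝ≥0∞) * l *
            ∫⁻ y in closedBall x (r x), h y) := by push_cast; ring
      _ ≤ q * (A * l * ∫⁻ y in closedBall x (r x), h y) := by
          gcongr; exact le_self_add
  calc ∫⁻ x in G, f x ^ 2 ≤ ∫⁻ x in ⋃ y : t, closedBall (y : EuclideanSpace ℝ (Fin 2)) (5 * r y),
        f x ^ 2 := by
        refine lintegral_mono_set' ?_
        filter_upwards [hGY] with x hx hxG
        obtain ⟨y, hy, hxy⟩ := htc x (hx hxG)
        exact mem_iUnion.2 ⟨⟨y, hy⟩, hxy (mem_closedBall_self (hr x (hx hxG)).1.le)⟩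
    _ ≤ ∑' y : t, ∫⁻ x in closedBall (y : EuclideanSpace ℝ (Fin 2)) (5 * r y), f x ^ 2 :=
        lintegral_iUnion_le _ _
    _ ≤ ∑' y : t, A * l * ∫⁻ x in closedBall (y : EuclideanSpace ℝ (Fin 2)) (r y), h x :=
        ENNReal.tsum_le_tsum fun y => hstep y y.2
    _ = A * l * ∫⁻ x in ⋃ y ∈ t, closedBall (y : EuclideanSpace ℝ (Fin 2)) (r y), h x := by
        rw [ENNReal.tsum_mul_left, lintegral_biUnion htcount
          (fun _ _ => measurableSet_closedBall) htd]
    _ ≤ A * l * ∫⁻ x, h x := by gcongr; exact Measure.restrict_le_self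
    _ = A * l * ∫⁻ x in {x | (l' : ℝ≥0∞) < f x}, f x := by
        rw [hh, lintegral_indicator (measurableSet_lt measurable_const hf)]

end Gehring

/-! ### Reverse Hölder inequality and higher integrability -/

theorem measureInLp_of_lintegral {d : ℕ} {μ : Measure (EuclideanSpace ℝ (Fin d))} {p : ℝ≥0}
    (hp : p ≠ 0) {U : Set (EuclideanSpace ℝ (Fin d))} (hac : μ.restrict U ≪ volume)
    (h : ∫⁻ x in U, μ.rnDeriv volume x ^ (p : ℝ) < ∞) : MeasureInLp μ p U := by
  refine ⟨hac, (Measure.measurable_rnDeriv _ _).aestronglyMeasurable, ?_⟩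
  rw [eLpNorm_lt_top_iff_lintegral_rpow_enorm_lt_top (by simpa using hp) ENNReal.coe_ne_top]
  simpa using h

theorem setLIntegral_rnDeriv_of_restrict {α : Type*} [MeasurableSpace α] {μ n : Measure α}
    [SigmaFinite μ] [SigmaFinite n] {U : Set α} (hU : MeasurableSet U) (h : μ.restrict U ≪ n) :
    ∫⁻ x in U, μ.rnDeriv n x ∂n = μ U := by
  rw [← Measure.restrict_apply_self μ U, ← Measure.setLIntegral_rnDeriv h U]
  refine setLIntegral_congr_fun_ae hU ?_
  filter_upwards [Measure.rnDeriv_restrict μ n hU] with x hx hxU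
  rw [hx, indicator_of_mem hxU]

theorem restrict_le_smul_restrict_mono {α : Type*} [MeasurableSpace α] {m₁ m₂ : Measure α}
    {B V : Set α} {M N : ℝ≥0} (h : m₁.restrict B ≤ (M : ℝ≥0∞) • m₂.restrict B) (hV : V ⊆ B)
    (hMN : M ≤ N) :
    m₁.restrict V ≤ (N : ℝ≥0∞) • m₂.restrict V := by
  refine Measure.le_iff.2 fun s hs => ?_
  rw [Measure.smul_apply, smul_eq_mul, Measure.restrict_apply hs, Measure.restrict_apply hs]
  refine (restrict_le_apply h (inter_subset_right.trans hV)).trans ?_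
  gcongr

/-- Push from x radially outwards up to the boundary of its ball. The cone only supplies a unit
vector for the case x = 0, ruling out dimension zero. -/
theorem norm_add_le_of_ball_subset {d : ℕ} (C : Cone d) {x : EuclideanSpace ℝ (Fin d)} {r R : ℝ}
    (hr : 0 < r) (h : ball x r ⊆ ball 0 R) : ‖x‖ + r ≤ R := by
  obtain ⟨u, hu, hxu⟩ : ∃ u : EuclideanSpace ℝ (Fin d), ‖u‖ = 1 ∧ x = ‖x‖ • u := by
    rcases eq_or_ne x 0 with rfl | hx
    · exact ⟨C.e, C.norm_e, by simp⟩
    · have hx' := norm_ne_zero_iff.2 hx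
      refine ⟨‖x‖⁻¹ • x, ?_, ?_⟩
      · rw [norm_smul, norm_inv, norm_norm, inv_mul_cancel₀ hx']
      · rw [smul_smul, mul_inv_cancel₀ hx', one_smul]
  refine le_of_forall_lt_imp_le_of_dense fun a ha => ?_
  by_cases hax : a ≤ ‖x‖
  · have : x ∈ ball (0 : EuclideanSpace ℝ (Fin d)) R := h (mem_ball_self hr)
    rw [mem_ball_zero_iff] at this
    linarith
  push Not at hax
  have hmem : a • u ∈ ball x r := by
    rw [mem_ball, dist_eq_norm]
    nth_rewrite 1 [hxu]
    rw [← sub_smul, norm_smul, hu, Real.norm_eq_abs, abs_of_pos (by linarith)]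
    linarith
  have := h hmem
  rw [mem_ball_zero_iff, norm_smul, hu, mul_one, Real.norm_eq_abs] at this
  exact ((le_abs_self a).trans_lt this).le

/-- The reverse Hölder inequality. -/
theorem exists_reverse_holder {μ : Measure (EuclideanSpace ℝ (Fin 2))} [IsLocallyFiniteMeasure μ]
    {C₁ C₂ : Cone 2} (hC : C₁.Independent C₂) {Ω₁ Ω₂ : Type*} [MeasurableSpace Ω₁]
    [MeasurableSpace Ω₂] (R₁ : AlbertiRep μ C₁ Ω₁) (R₂ : AlbertiRep μ C₂ Ω₂)
    {U : Set (EuclideanSpace ℝ (Fin 2))} {M : ℝ≥0}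
    (hA₁ : μ.restrict U ≤ (M : ℝ≥0∞) • R₁.ν.restrict U)
    (hA₂ : μ.restrict U ≤ (M : ℝ≥0∞) • R₂.ν.restrict U)
    (hB₁ : R₁.ν.restrict U ≤ (M : ℝ≥0∞) • μ.restrict U)
    (hB₂ : R₂.ν.restrict U ≤ (M : ℝ≥0∞) • μ.restrict U) :
    ∃ K : ℝ≥0, ∀ (x : EuclideanSpace ℝ (Fin 2)) (r : ℝ), 0 < r → ball x (2 * r) ⊆ U →
      ENNReal.ofReal (r ^ 2) * ∫⁻ y in ball x r, μ.rnDeriv volume y ^ 2 ≤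
        K * μ (ball x r) ^ 2 := by
  obtain ⟨A, hA⟩ := exists_doubling hC R₁ R₂ hA₁ hA₂ hB₁ hB₂
  obtain ⟨K, hK⟩ := exists_lintegral_rnDeriv_sq_le hC R₁ R₂
  have hθ₁ := C₁.θ_pos
  have hθ₂ := C₂.θ_pos
  set t : ℝ≥0 := Real.toNNReal (C₁.θ * C₂.θ) with ht
  have ht0 : t ≠ 0 := by
    rw [ht, ne_eq, Real.toNNReal_eq_zero, not_le]; positivity
  refine ⟨t⁻¹ * (K * M ^ 2 * (M * A) ^ 2), fun x r hr hU => ?_⟩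
  have hU' : ball x r ⊆ U := (ball_subset_ball (by linarith)).trans hU
  obtain ⟨-, h2⟩ := hK (ball x r) M measurableSet_ball
    (restrict_le_smul_restrict_mono hA₁ hU' le_rfl) (restrict_le_smul_restrict_mono hA₂ hU' le_rfl)
  set p₁ := R₁.P {ω | R₁.curveMeasure ω (ball x r) ≠ 0}
  set p₂ := R₂.P {ω | R₂.curveMeasure ω (ball x r) ≠ 0}
  set I := ∫⁻ y in ball x r, μ.rnDeriv volume y ^ 2
  -- The lower bound enters here: graphs hitting the ball are paid for by ν₁ of the double ball,
  -- hence by μ, and doubling returns to the original ball.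
  have e₁ : ENNReal.ofReal (C₁.θ * r) * p₁ ≤ M * A * μ (ball x r) := by
    calc _ ≤ R₁.ν (ball x (2 * r)) := R₁.mul_measure_hit_le x r
      _ ≤ M * μ (ball x (2 * r)) := restrict_le_apply hB₁ hU
      _ ≤ M * (A * μ (ball x r)) := by gcongr; exact hA x r hr hU
      _ = _ := by ring
  have e₂ : ENNReal.ofReal (C₂.θ * r) * p₂ ≤ M * A * μ (ball x r) := by
    calc _ ≤ R₂.ν (ball x (2 * r)) := R₂.mul_measure_hit_le x r
      _ ≤ M * μ (ball x (2 * r)) := restrict_le_apply hB₂ hU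
      _ ≤ M * (A * μ (ball x r)) := by gcongr; exact hA x r hr hU
      _ = _ := by ring
  have ht' : (t : ℝ≥0∞) * ENNReal.ofReal (r ^ 2) =
      ENNReal.ofReal (C₁.θ * r) * ENNReal.ofReal (C₂.θ * r) := by
    change ENNReal.ofReal _ * _ = _
    rw [← ENNReal.ofReal_mul (by positivity), ← ENNReal.ofReal_mul (by positivity)]
    congr 1
    ring
  have hmain : (t : ℝ≥0∞) * (ENNReal.ofReal (r ^ 2) * I) ≤
      K * M ^ 2 * (M * A) ^ 2 * μ (ball x r) ^ 2 := by
    calc (t : ℝ≥0∞) * (ENNReal.ofReal (r ^ 2) * I)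
        ≤ t * (ENNReal.ofReal (r ^ 2) * (K * M ^ 2 * (p₁ * p₂))) := by gcongr
      _ = K * M ^ 2 * ((t * ENNReal.ofReal (r ^ 2)) * (p₁ * p₂)) := by ring
      _ = K * M ^ 2 * ((ENNReal.ofReal (C₁.θ * r) * p₁) * (ENNReal.ofReal (C₂.θ * r) * p₂)) := by
          rw [ht']; ring
      _ ≤ K * M ^ 2 * ((M * A * μ (ball x r)) * (M * A * μ (ball x r))) := by gcongr
      _ = _ := by ring
  have htE : (t : ℝ≥0∞) ≠ 0 := by simpa using ht0
  calc ENNReal.ofReal (r ^ 2) * I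
      = (t : ℝ≥0∞)⁻¹ * (t * (ENNReal.ofReal (r ^ 2) * I)) := by
        rw [← mul_assoc, ENNReal.inv_mul_cancel htE ENNReal.coe_ne_top, one_mul]
    _ ≤ (t : ℝ≥0∞)⁻¹ * (K * M ^ 2 * (M * A) ^ 2 * μ (ball x r) ^ 2) := by gcongr
    _ = _ := by
        push_cast
        rw [ENNReal.coe_inv ht0]
        ring

theorem rpow_half_le_of_mul_le {I m : ℝ≥0∞} {K r : ℝ≥0} (hr : 0 < r)
    (h : (r : ℝ≥0∞) ^ 2 * I ≤ K * m ^ 2) :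
    (I / (r : ℝ≥0∞) ^ 2) ^ (1 / 2 : ℝ) ≤ ((K + 1 : ℝ≥0) : ℝ≥0∞) / (r : ℝ≥0∞) ^ 2 * m := by
  rw [one_div, ENNReal.rpow_inv_le_iff (by norm_num), ENNReal.rpow_two]
  set R := (r : ℝ≥0∞) ^ 2
  have hR0 : R ≠ 0 := pow_ne_zero _ (by simpa using hr.ne')
  have hRt : R ≠ ∞ := ENNReal.pow_ne_top ENNReal.coe_ne_top
  -- Using K + 1 in place of √K avoids a root and also gives a constant at least 1.
  have hK : (K : ℝ≥0∞) ≤ ((K + 1 : ℝ≥0) : ℝ≥0∞) ^ 2 := by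
    norm_cast
    calc K ≤ K + (K ^ 2 + K + 1) := le_self_add
      _ = (K + 1) ^ 2 := by ring
  calc I / R = (R * R⁻¹) * I * R⁻¹ := by rw [ENNReal.mul_inv_cancel hR0 hRt, one_mul]; rfl
    _ = (R * I) * (R⁻¹ * R⁻¹) := by ring
    _ ≤ (((K + 1 : ℝ≥0) : ℝ≥0∞) ^ 2 * m ^ 2) * (R⁻¹ * R⁻¹) := by
        gcongr ?_ * _; exact h.trans (by gcongr)
    _ = _ := by rw [div_eq_mul_inv]; ring

/-- Higher integrability from the reverse Hölder inequality and the doubling property. -/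
theorem exists_measureInLp_of_reverse_holder {μ : Measure (EuclideanSpace ℝ (Fin 2))}
    [IsLocallyFiniteMeasure μ] {A K : ℝ≥0} (hac : μ.restrict (ball 0 (1 / 2)) ≪ volume)
    (hA : ∀ (x : EuclideanSpace ℝ (Fin 2)) (r : ℝ), 0 < r → ball x (2 * r) ⊆ ball 0 2 →
      μ (ball x (2 * r)) ≤ A * μ (ball x r))
    (hK : ∀ (x : EuclideanSpace ℝ (Fin 2)) (r : ℝ), 0 < r → ball x (2 * r) ⊆ ball 0 2 →
      ENNReal.ofReal (r ^ 2) * ∫⁻ y in ball x r, μ.rnDeriv volume y ^ 2 ≤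
        K * μ (ball x r) ^ 2) :
    ∃ ε : ℝ≥0, 0 < ε ∧ MeasureInLp μ (2 + ε) (ball 0 (1 / 2)) := by
  set X : Set (EuclideanSpace ℝ (Fin 2)) := ball 0 (1 / 2) with hXdef
  set m := μ.restrict X with hm
  have hX : MeasurableSet X := measurableSet_ball
  have hfinm : IsFiniteMeasure m := isFiniteMeasure_restrict.2 measure_ball_lt_top.ne
  have hrn : m.rnDeriv volume =ᵐ[volume] X.indicator (μ.rnDeriv volume) :=
    Measure.rnDeriv_restrict μ volume hX
  have hsub : ∀ (y : EuclideanSpace ℝ (Fin 2)) (r : ℝ), ‖y‖ + r ≤ 2 → ball y r ⊆ ball 0 2 := by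
    intro y r h
    exact ball_subset_ball' (by rw [dist_zero_right]; linarith)
  have hle : ∀ S, ∫⁻ y in S, m.rnDeriv volume y ^ 2 ≤ ∫⁻ y in S, μ.rnDeriv volume y ^ 2 := by
    intro S
    refine lintegral_mono_ae (ae_restrict_of_ae ?_)
    filter_upwards [hrn] with y hy
    rw [hy]
    gcongr
    exact indicator_le_self _ _ _
  have hfin : ∫⁻ x, m.rnDeriv volume x ^ 2 ≠ ∞ := by
    have h1 : ∫⁻ x, m.rnDeriv volume x ^ 2 = ∫⁻ x in X, μ.rnDeriv volume x ^ 2 := by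
      rw [← lintegral_indicator hX]
      refine lintegral_congr_ae ?_
      filter_upwards [hrn] with x hx
      rw [hx]
      by_cases hxX : x ∈ X <;> simp [hxX]
    have h2 := hK 0 (1 / 2) (by norm_num) (hsub _ _ (by norm_num))
    rw [h1]
    intro htop
    rw [← hXdef, htop, ENNReal.mul_top (by rw [ENNReal.ofReal_ne_zero_iff]; norm_num),
      top_le_iff] at h2
    exact ENNReal.mul_ne_top ENNReal.coe_ne_top
      (ENNReal.pow_ne_top measure_ball_lt_top.ne) h2
  have hsupp : ∀ᵐ x, m.rnDeriv volume x ≠ 0 → x ∈ X := by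
    filter_upwards [hrn] with x hx hx0
    rw [hx] at hx0
    exact mem_of_indicator_ne_zero hx0
  have hRH : ∀ x ∈ X, ∀ s : ℝ, 0 < s → s ≤ 1 / 20 →
      ENNReal.ofReal (s ^ 2) * ∫⁻ y in closedBall x (5 * s), m.rnDeriv volume y ^ 2 ≤
        (K * (A ^ 4) ^ 2 : ℝ≥0) * m (closedBall x (6 * s)) ^ 2 := by
    intro x hx s hs hs'
    have hxn : ‖x‖ < 1 / 2 := mem_ball_zero_iff.1 hx
    -- Gehring's lemma is applied to μ cut off to X, so balls centred near the boundary of X lose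
    -- mass. Moving x inwards gives B(y, s/2) inside both X and B(x,6s). Four doublings reach
    -- B(y,8s), which contains B(x,6s); the cap s ≤ 1/20 keeps all balls used inside B(0,2).
    set y := (1 - s) • x with hy
    have hyn : ‖y‖ = (1 - s) * ‖x‖ := by
      rw [hy, norm_smul, Real.norm_eq_abs, abs_of_nonneg (by linarith)]
    have hxy : dist x y = s * ‖x‖ := by
      rw [dist_eq_norm, hy, sub_smul, one_smul, sub_sub_cancel, norm_smul, Real.norm_eq_abs,
        abs_of_pos hs]
    have hxn0 := norm_nonneg x
    have hy2 : ‖y‖ ≤ 1 / 2 - s / 2 := by rw [hyn]; nlinarith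
    have hxy2 : dist x y ≤ s / 2 := by rw [hxy]; nlinarith
    have d1 := hA y (s / 2) (by positivity) (hsub _ _ (by linarith))
    have d2 := hA y (2 * (s / 2)) (by positivity) (hsub _ _ (by linarith))
    have d3 := hA y (2 * (2 * (s / 2))) (by positivity) (hsub _ _ (by linarith))
    have d4 := hA y (2 * (2 * (2 * (s / 2)))) (by positivity) (hsub _ _ (by linarith))
    have hdbl : μ (ball x (6 * s)) ≤ (A ^ 4 : ℝ≥0) * m (closedBall x (6 * s)) := by
      calc μ (ball x (6 * s)) ≤ μ (ball y (2 * (2 * (2 * (2 * (s / 2)))))) :=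
            measure_mono (ball_subset_ball' (by linarith))
        _ ≤ A * (A * (A * (A * μ (ball y (s / 2))))) := by
            refine d4.trans ?_
            gcongr
            refine d3.trans ?_
            gcongr
            refine d2.trans ?_
            gcongr
        _ = (A ^ 4 : ℝ≥0) * μ (ball y (s / 2)) := by push_cast; ring
        _ ≤ (A ^ 4 : ℝ≥0) * m (closedBall x (6 * s)) := by
            gcongr _ * ?_
            rw [hm, Measure.restrict_apply measurableSet_closedBall]
            refine measure_mono (subset_inter ?_ ?_)
            · refine ball_subset_closedBall.trans (closedBall_subset_closedBall' ?_)
              rw [dist_comm]; linarith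
            · exact ball_subset_ball' (by rw [dist_zero_right]; linarith)
    calc ENNReal.ofReal (s ^ 2) * ∫⁻ z in closedBall x (5 * s), m.rnDeriv volume z ^ 2
        ≤ ENNReal.ofReal ((6 * s) ^ 2) * ∫⁻ z in ball x (6 * s), μ.rnDeriv volume z ^ 2 := by
          refine mul_le_mul' (ENNReal.ofReal_le_ofReal (by nlinarith)) ?_
          exact (hle _).trans (lintegral_mono_set (closedBall_subset_ball (by linarith)))
      _ ≤ K * μ (ball x (6 * s)) ^ 2 := hK x (6 * s) (by positivity) (hsub _ _ (by linarith))
      _ ≤ K * ((A ^ 4 : ℝ≥0) * m (closedBall x (6 * s))) ^ 2 := by gcongr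
      _ = _ := by push_cast; ring
  obtain ⟨ε, hε, hint⟩ := exists_lintegral_rnDeriv_rpow_lt_top m hac hfin hsupp
    (by norm_num) hRH
  refine ⟨ε, hε, ?_⟩
  have : MeasureInLp μ ((2 + ε : ℝ≥0) : ℝ≥0∞) X := by
    refine measureInLp_of_lintegral (by positivity) hac (lt_of_eq_of_lt ?_ hint)
    rw [← lintegral_indicator hX]
    refine lintegral_congr_ae ?_
    filter_upwards [hrn] with x hx
    rw [hx]
    by_cases hxX : x ∈ X
    · simp [hxX]
    · simp only [hxX, not_false_eq_true, indicator_of_notMem]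
      rw [ENNReal.zero_rpow_of_pos (by positivity)]
  simpa using this

end Alberti

/-! ### Proof of the theorem -/

theorem theorem1p1
    (μ : Measure (EuclideanSpace ℝ (Fin 2))) [IsLocallyFiniteMeasure μ]
    (C₁ C₂ : Alberti.Cone 2) (hC : C₁.Independent C₂)
    {Ω₁ Ω₂ : Type*} [MeasurableSpace Ω₁] [MeasurableSpace Ω₂]
    (R₁ : Alberti.AlbertiRep μ C₁ Ω₁) (R₂ : Alberti.AlbertiRep μ C₂ Ω₂) :
    (R₁.BoA → R₂.BoA → Alberti.MeasureInLp μ 2 univ) ∧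
    (R₁.BoAOn (ball 0 2) → R₁.BoBOn (ball 0 2) →
      R₂.BoAOn (ball 0 2) → R₂.BoBOn (ball 0 2) →
      μ.restrict (ball 0 1) ≪ volume ∧
      (∃ C : ℝ≥0, 1 ≤ C ∧ ∀ (x : EuclideanSpace ℝ (Fin 2)) (r : ℝ≥0), 0 < r →
        ball x r ⊆ ball 0 1 →
        ((∫⁻ y in ball x r, μ.rnDeriv volume y ^ 2) / (r : ℝ≥0∞) ^ 2) ^ (1 / 2 : ℝ) ≤
          (C : ℝ≥0∞) / (r : ℝ≥0∞) ^ 2 * ∫⁻ y in ball x r, μ.rnDeriv volume y) ∧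
      ∃ ε : ℝ≥0, 0 < ε ∧ Alberti.MeasureInLp μ (2 + ε) (ball 0 (1 / 2))) := by
  obtain ⟨K₀, hK₀⟩ := Alberti.exists_lintegral_rnDeriv_sq_le hC R₁ R₂
  refine ⟨fun h₁ h₂ => ?_, fun hA₁ hB₁ hA₂ hB₂ => ?_⟩
  · have h₁' : R₁.BoAOn univ := by
      rw [Alberti.AlbertiRep.BoAOn, Measure.restrict_univ]; exact h₁
    have h₂' : R₂.BoAOn univ := by
      rw [Alberti.AlbertiRep.BoAOn, Measure.restrict_univ]; exact h₂
    obtain ⟨M₁, hM₁⟩ := h₁'.exists_restrict_le MeasurableSet.univ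
    obtain ⟨M₂, hM₂⟩ := h₂'.exists_restrict_le MeasurableSet.univ
    obtain ⟨hac, hle⟩ := hK₀ univ (max M₁ M₂) MeasurableSet.univ
      (Alberti.restrict_le_smul_restrict_mono hM₁ Subset.rfl (le_max_left _ _))
      (Alberti.restrict_le_smul_restrict_mono hM₂ Subset.rfl (le_max_right _ _))
    have := R₁.finite_P
    have := R₂.finite_P
    have : Alberti.MeasureInLp μ ((2 : ℝ≥0) : ℝ≥0∞) univ := by
      refine Alberti.measureInLp_of_lintegral two_ne_zero hac ?_
      refine lt_of_le_of_lt (by simpa using hle) ?_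
      exact ENNReal.mul_lt_top (ENNReal.mul_lt_top ENNReal.coe_lt_top
        (ENNReal.pow_lt_top ENNReal.coe_lt_top))
        (ENNReal.mul_lt_top (measure_lt_top _ _) (measure_lt_top _ _))
    simpa using this
  · obtain ⟨M₁, hM₁⟩ := hA₁.exists_restrict_le measurableSet_ball
    obtain ⟨M₂, hM₂⟩ := hA₂.exists_restrict_le measurableSet_ball
    obtain ⟨N₁, hN₁⟩ := hB₁.exists_restrict_le measurableSet_ball
    obtain ⟨N₂, hN₂⟩ := hB₂.exists_restrict_le measurableSet_ball
    set M := max (max M₁ M₂) (max N₁ N₂)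
    replace hM₁ := Alberti.restrict_le_smul_restrict_mono hM₁ Subset.rfl
      (show M₁ ≤ M by simp [M])
    replace hM₂ := Alberti.restrict_le_smul_restrict_mono hM₂ Subset.rfl
      (show M₂ ≤ M by simp [M])
    replace hN₁ := Alberti.restrict_le_smul_restrict_mono hN₁ Subset.rfl
      (show N₁ ≤ M by simp [M])
    replace hN₂ := Alberti.restrict_le_smul_restrict_mono hN₂ Subset.rfl
      (show N₂ ≤ M by simp [M])
    have hac : ∀ V : Set (EuclideanSpace ℝ (Fin 2)), MeasurableSet V → V ⊆ ball 0 2 →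
        μ.restrict V ≪ volume := fun V hVm hV =>
      (hK₀ V M hVm (Alberti.restrict_le_smul_restrict_mono hM₁ hV le_rfl)
        (Alberti.restrict_le_smul_restrict_mono hM₂ hV le_rfl)).1
    obtain ⟨K, hK⟩ := Alberti.exists_reverse_holder hC R₁ R₂ hM₁ hM₂ hN₁ hN₂
    obtain ⟨A, hA⟩ := Alberti.exists_doubling hC R₁ R₂ hM₁ hM₂ hN₁ hN₂
    refine ⟨hac _ measurableSet_ball (ball_subset_ball (by norm_num)),
      ⟨K + 1, le_add_self, fun x r hr hxr => ?_⟩,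
      Alberti.exists_measureInLp_of_reverse_holder
        (hac _ measurableSet_ball (ball_subset_ball (by norm_num))) hA hK⟩
    have hr' : (0 : ℝ) < r := by exact_mod_cast hr
    -- From ‖x‖ + r ≤ 1 it follows that ‖x‖ + 2r ≤ 2: the double ball stays in B(0,2), where the
    -- representations are bounded.
    have hnorm := Alberti.norm_add_le_of_ball_subset C₁ hr' hxr
    have hsub : ball x (2 * r : ℝ) ⊆ ball (0 : EuclideanSpace ℝ (Fin 2)) 2 :=
      ball_subset_ball' (by rw [dist_zero_right]; linarith [norm_nonneg x])
    rw [Alberti.setLIntegral_rnDeriv_of_restrict measurableSet_ball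
      (hac _ measurableSet_ball (hxr.trans (ball_subset_ball (by norm_num))))]
    refine Alberti.rpow_half_le_of_mul_le hr ?_
    have := hK x r hr' hsub
    rwa [ENNReal.ofReal_pow hr'.le, ENNReal.ofReal_coe_nnreal] at this
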